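/- Let $C\ge 3$ and $m>C$ be integers, $\mathcal{X}$ a measurable space, $\mathcal{Y}=\{1,\dots,C\}$, and $P$ a probability measure on $\mathcal{X}\times\mathcal{Y}$. Let $M\ge 1$ and let $\mathcal{G}=\prod_{k=1}^C\mathcal{G}_k$, where each $\mathcal{G}_k$ is a uniform Glivenko-Cantelli class of measurable functions from $\mathcal{X}$ to $[-M,M]$, that is, for every $\epsilon>0$, $$\lim_{n\to\infty}\ \sup_{Q}\ Q^{\infty}\Big(\sup_{n'\ge n}\ \sup_{f\in\mathcal{G}_k}\Big|\frac1{n'}\sum_{i=1}^{n'} f(t_i)-\int f\,dQ\Big|>\epsilon\Big)=0,$$ where $Q$ ranges over the probability measures on $\mathcal{X}$. For $g=(g_k)_{1\le k\le C}\in\mathcal{G}$ put $f_g(x,k)=\frac12\big(g_k(x)-\max_{l\ne k}g_l(x)\big)$; the class $\{f_g: g\in\mathcal{G}\}$ is assumed to be measurable in the sense that, for all $n$ and all Borel sets $B\subset\mathbb{R}^n$, the set of those $(z_1,\dots,z_n)$ for which $(f_g(z_1),\dots,f_g(z_n))\in B$ for some $g\in\mathcal{G}$ is measurable for the completion of $P^n$.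 Let $$L(g)=P\{(x,y): f_g(x,y)\le 0\}$$ be the probability of error of the classifier that assigns to $x$ the index of the largest $g_k(x)$ (a tie counts as an error). For $\gamma\in(0,1]$ and a sample $(Z_1,\dots,Z_m)\sim P^m$ let $$L_{\gamma,m}(g)=\frac1m\sum_{i=1}^m \mathbf{1}_{\{f_g(Z_i)<\gamma\}}.$$ For $\epsilon\in(0,M]$ let $d(\epsilon)=\max_{1\le k\le C}\epsilon\text{-dim}(\mathcal{G}_k)$, where the fat-shattering dimension $\epsilon\text{-dim}(\mathcal{G}_k)$ is the largest $n$ such that there are distinct $t_1,\dots,t_n\in\mathcal{X}$ and $b\in[-M,M]^n$ for which every $l\in\{-1,1\}^n$ admits an $f\in\mathcal{G}_k$ with $l_i(f(t_i)-b_i)\ge\epsilon$ for all $i$ (it is $0$ if there is no such $n\ge1$). Then, for fixed $\gamma\in(0,1]$ and $\delta\in(0,1)$, the number $d(\gamma/8)$ is finite and, with $P^m$-probability at least $1-\delta$, simultaneously for all $g\in\mathcal{G}$, $$L(g)\le L_{\gamma,m}(g)+\sqrt{\frac2m\Big(3C\,d\Big(\frac{\gamma}{8}\Big)\ln^2\Big(\frac{128M^2m}{\gamma^2}\Big)+\ln\Big(\frac2\delta\Big)\Big)}+\frac1m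 .$$ -/

import Mathlib

open MeasureTheory Filter Topology

noncomputable section

namespace MarginClassification

section Classes

variable {T : Type*}

/-- A class `F` of real functions is a uniform Glivenko-Cantelli class: its members are measurable
and, uniformly over all probability measures `Q`, the largest deviation, over `f ∈ F` and over the
sample sizes `n' ≥ n`, between the empirical means of `f` and its expectation tends to `0` in
probability as `n → ∞`. The probability is that of the infinite product measure (outer
probability if the event is not measurable). -/
def IsUniformGC [MeasurableSpace T] (F : Set (T → ℝ)) : Prop :=
  (∀ f ∈ F, Measurable f) ∧
  ∀ ε : ℝ, 0 < ε →
    Tendsto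
      (fun n : ℕ => ⨆ Q : ProbabilityMeasure T,
        Measure.infinitePi (fun _ : ℕ => (Q : Measure T))
          {t : ℕ → T | ∃ n' : ℕ, n ≤ n' ∧ ∃ f ∈ F,
            ε < |(1 / (n' : ℝ)) * ∑ i ∈ Finset.range n', f (t i) - ∫ x, f x ∂(Q : Measure T)|})
      atTop (𝓝 0)

/-- The finite set `s` is `γ`-shattered by the class `F` of functions with values in `S`:
there is a witness `b` with values in `S` such that all sign patterns `l` are realized around `b`
with margin `γ`. -/
def Shatters (F : Set (T → ℝ)) (S : Set ℝ) (γ : ℝ) (s : Finset T) : Prop :=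
  ∃ b : T → ℝ, (∀ t ∈ s, b t ∈ S) ∧
    ∀ l : T → ℝ, (∀ t ∈ s, l t = -1 ∨ l t = 1) →
      ∃ f ∈ F, ∀ t ∈ s, γ ≤ l t * (f t - b t)

/-- The fat-shattering dimension with margin `γ`: the largest cardinality of a `γ`-shattered set,
`⊤` if there is no largest one (and `0` if no nonempty set is shattered). -/
def fatDim (F : Set (T → ℝ)) (S : Set ℝ) (γ : ℝ) : ℕ∞ :=
  ⨆ (s : Finset T) (_ : Shatters F S γ s), (s.card : ℕ∞)

/-- Measurability of a class of functions with respect to `μ`: for each sample size `n` and each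
Borel condition `B` on `n` real values, the event that some member of the class fulfils the
condition on the sample is measurable for the completion of `μ^n`. Equivalently, the supremum over
`f ∈ F` of any Borel function of `(f (t 1), …, f (t n))` is measurable for this completion. -/
def IsMeasurableClass [MeasurableSpace T] (μ : Measure T) (F : Set (T → ℝ)) : Prop :=
  ∀ (n : ℕ) (B : Set (Fin n → ℝ)), MeasurableSet B →
    NullMeasurableSet {t : Fin n → T | ∃ f ∈ F, (fun i => f (t i)) ∈ B}
      (Measure.pi fun _ : Fin n => μ)

end Classes

section Margin

variable {X : Type*} {C : ℕ}

/-- The class `∏ k, 𝒢 k` of vector-valued functions consists of functions with values in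
`[-M, M]^C`, `M ≥ 1`, and the classes of component functions are uniform Glivenko-Cantelli. -/
structure IsMarginClass [MeasurableSpace X] (M : ℝ) (𝒢 : Fin C → Set (X → ℝ)) : Prop where
  one_le : 1 ≤ M
  mem_Icc : ∀ k, ∀ f ∈ 𝒢 k, ∀ x, f x ∈ Set.Icc (-M) M
  gc : ∀ k, IsUniformGC (𝒢 k)

open Classical in
/-- The decision rule: the category of highest score, or the dummy category `none` in case of
a tie. -/
def decisionRule (g : Fin C → X → ℝ) (x : X) : Option (Fin C) :=
  if h : ∃! k, ∀ l, g l x ≤ g k x then some h.choose else none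

/-- The margin function `f_g (x, k) = (g_k x - max_{l ≠ k} g_l x) / 2`. -/
def marginFun (g : Fin C → X → ℝ) (z : X × Fin C) : ℝ :=
  (1 / 2) * (g z.2 z.1 - ⨆ l : {l : Fin C // l ≠ z.2}, g l z.1)

/-- The class of the margin functions `f_g`, for `g` in the product of the classes `𝒢 k`. -/
def marginFunClass (𝒢 : Fin C → Set (X → ℝ)) : Set (X × Fin C → ℝ) :=
  marginFun '' Set.univ.pi 𝒢

/-- The indicator loss `t ↦ 1_{t ≤ 0}`. -/
def indicatorLoss (t : ℝ) : ℝ := (Set.Iic (0 : ℝ)).indicator 1 t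

/-- The margin loss `t ↦ 1_{t < γ}`. -/
def marginLoss (γ t : ℝ) : ℝ := (Set.Iio γ).indicator 1 t

/-- The expected risk. -/
def risk [MeasurableSpace X] (P : Measure (X × Fin C)) (g : Fin C → X → ℝ) : ℝ :=
  ∫ z, indicatorLoss (marginFun g z) ∂P

/-- The empirical margin risk on the sample `z`. -/
def empiricalMarginRisk {m : ℕ} (γ : ℝ) (z : Fin m → X × Fin C) (g : Fin C → X → ℝ) : ℝ :=
  (1 / (m : ℝ)) * ∑ i, marginLoss γ (marginFun g (z i))

/-- The maximum over `k` of the fat-shattering dimensions of the classes `𝒢 k` of functions with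
values in `[-M, M]`. -/
def maxFatDim (M : ℝ) (𝒢 : Fin C → Set (X → ℝ)) (ε : ℝ) : ℕ∞ :=
  ⨆ k, fatDim (𝒢 k) (Set.Icc (-M) M) ε

/-- The margin function is nonpositive exactly when the decision rule errs. -/
theorem marginFun_nonpos_iff (hC : 2 ≤ C) (g : Fin C → X → ℝ) (z : X × Fin C) :
    marginFun g z ≤ 0 ↔ decisionRule g z.1 ≠ some z.2 := by
  obtain ⟨x, k⟩ := z
  have hne : Nonempty {l : Fin C // l ≠ k} := by
    have : Nontrivial (Fin C) := Fin.nontrivial_iff_two_le.2 hC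
    obtain ⟨l, hl⟩ := exists_ne k
    exact ⟨⟨l, hl⟩⟩
  have h1 : 0 < marginFun g (x, k) ↔ ∀ l, l ≠ k → g l x < g k x := by
    have hbdd : BddAbove (Set.range fun l : {l : Fin C // l ≠ k} => g l x) :=
      (Set.finite_range _).bddAbove
    unfold marginFun
    constructor
    · intro h l hl
      have := le_ciSup hbdd ⟨l, hl⟩
      simp only at this h
      linarith
    · intro h
      obtain ⟨l, hl⟩ := exists_eq_ciSup_of_finite (f := fun l : {l : Fin C // l ≠ k} => g l x)
      have := h l l.2
      simp only at hl ⊢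
      linarith
  have h2 : decisionRule g x = some k ↔ ∀ l, l ≠ k → g l x < g k x := by
    unfold decisionRule
    constructor
    · intro h l hl
      split_ifs at h with hu
      have hk : hu.choose = k := by simpa using h
      have hs := hu.choose_spec
      rw [hk] at hs
      refine lt_of_le_of_ne (hs.1 l) fun e => hl (hs.2 l fun j => ?_)
      exact e ▸ hs.1 j
    · intro h
      have hle : ∀ l, g l x ≤ g k x := fun l => by
        by_cases e : l = k
        · rw [e]
        · exact (h l e).le
      have hu : ∃! k, ∀ l, g l x ≤ g k x := by
        refine ⟨k, hle, fun j hj => ?_⟩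
        by_contra e
        exact absurd (h j e) (not_lt.2 (hj k))
      rw [dif_pos hu]
      exact congrArg some (hu.choose_spec.2 k hle).symm
  rw [← not_lt, not_iff_not]
  exact h1.trans h2.symm

theorem measurable_marginFun [MeasurableSpace X] {g : Fin C → X → ℝ}
    (hg : ∀ k, Measurable (g k)) : Measurable (marginFun g) := by
  refine measurable_from_prod_countable_left fun k => ?_
  refine Measurable.const_mul ((hg k).sub ?_) _
  exact Measurable.iSup fun l : {l : Fin C // l ≠ k} => hg l

/-- The expected risk is the probability of error. -/
theorem risk_eq [MeasurableSpace X] (hC : 2 ≤ C) (P : Measure (X × Fin C))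
    {g : Fin C → X → ℝ} (hg : ∀ k, Measurable (g k)) :
    risk P g = P.real {z | decisionRule g z.1 ≠ some z.2} := by
  have hs : {z : X × Fin C | decisionRule g z.1 ≠ some z.2} = marginFun g ⁻¹' Set.Iic 0 := by
    ext z
    exact (marginFun_nonpos_iff hC g z).symm
  rw [hs, ← integral_indicator_one (measurable_marginFun hg measurableSet_Iic)]
  rfl

end Margin

end MarginClassification

end

/-! Write η for the square root in the bound and L = ln(128 M² m / γ²). If the bound fails for some
g on a first sample, then on an independent second sample g makes more than m · risk − 1 errors with
probability at least 1/m (`inv_le_measure_sum_indicatorLoss`), so these errors exceed the margin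
errors on the first sample by more than m η. The failure probability is thus at most m times that of
a deviation between the halves of a double sample (`exists_measurableSet_of_deviationSet_le`). The
loss of one error is the source of the term 1/m.

Exchanging paired points at random preserves the law of the double sample. For a fixed double
sample, each margin function is replaced by one of finitely many that are within γ/2 of it at all
points. For each of these, Hoeffding's inequality for random signs (`card_rademacher_le`) gives the
factor exp(-m η²/2), and the union bound costs the size of the cover.

The map g ↦ f_g is nonexpansive, so the cover comes from a product of covers of the classes `𝒢 k`.
After quantization with step γ/4, a maximal 2-separated family is a cover. Its size is bounded by a
Sauer-Shelah argument (`IsTwoSeparated.card_lt`): a large separated family strongly shatters many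
words, while dimension d at scale γ/8 leaves room for few. Each component needs at most exp(3 d L² −
L) functions, and the spare exp(-L) ≤ 1/m pays for the factor m of the symmetrization.

For d = 0 all members of a component class are uniformly close, and Hoeffding's inequality for one
function suffices. Finiteness of d (`IsUniformGC.exists_card_le`) holds because, under the uniform
law on a shattered set much larger than the sample, every sample admits a function with a large
deviation. -/

namespace MarginClassification

/-! ### Combinatorics of separated families of integer-valued functions -/

section StrongShattering

variable {ι : Type*}

/-- The word `w` codes the set `{i | w i ≠ 0}` together with the levels `w i` at its points.
It is strongly shattered by the class `F` of integer-valued functions if every subset of this set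
is cut out by a member of `F` avoiding the levels. -/
def StronglyShatters (F : Finset (ι → ℕ)) (w : ι → ℕ) : Prop :=
  ∀ S : Set ι, ∃ f ∈ F, ∀ i, w i ≠ 0 → (i ∈ S → w i + 1 ≤ f i) ∧ (i ∉ S → f i + 1 ≤ w i)

/-- Any two different members of `F` differ by at least `2` somewhere. -/
def IsTwoSeparated (F : Finset (ι → ℕ)) : Prop :=
  ∀ f ∈ F, ∀ g ∈ F, f ≠ g → ∃ i, f i + 2 ≤ g i ∨ g i + 2 ≤ f i

theorem StronglyShatters.mono {F F' : Finset (ι → ℕ)} (h : F ⊆ F') {w : ι → ℕ}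
    (hw : StronglyShatters F w) : StronglyShatters F' w := fun S => by
  obtain ⟨f, hf, h'⟩ := hw S
  exact ⟨f, h hf, h'⟩

/-- A nonzero level needs values strictly above and strictly below it. Hence words shattered by a
fiber over x leave x free for a new level. -/
theorem StronglyShatters.eq_zero_of_const {F : Finset (ι → ℕ)} {w : ι → ℕ}
    (hw : StronglyShatters F w) {x : ι} {v : ℕ} (hF : ∀ f ∈ F, f x = v) : w x = 0 := by
  by_contra h0
  obtain ⟨f, hf, h⟩ := hw Set.univ
  obtain ⟨f', hf', h'⟩ := hw ∅
  have h1 := (h x h0).1 trivial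
  have h2 := (h' x h0).2 (fun h => h)
  rw [hF f hf] at h1
  rw [hF f' hf'] at h2
  omega

-- The level i + 1 lies strictly between i and j, which is where the gap of 2 is used. A subset is
-- cut out by a member of `F₂` if it contains x and by a member of `F₁` otherwise.
open Classical in
theorem StronglyShatters.update {F F₁ F₂ : Finset (ι → ℕ)} (h₁ : F₁ ⊆ F) (h₂ : F₂ ⊆ F) {x : ι}
    {i j : ℕ} (hij : i + 2 ≤ j) (hF₁ : ∀ f ∈ F₁, f x = i) (hF₂ : ∀ f ∈ F₂, f x = j) {w : ι → ℕ}
    (hw₁ : StronglyShatters F₁ w) (hw₂ : StronglyShatters F₂ w) :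
    StronglyShatters F (Function.update w x (i + 1)) := fun S => by
  by_cases hx : x ∈ S
  · obtain ⟨f, hf, h⟩ := hw₂ S
    refine ⟨f, h₂ hf, fun y hy => ?_⟩
    by_cases hyx : y = x
    · subst hyx
      rw [Function.update_self, hF₂ f hf]
      exact ⟨fun _ => hij, fun h => absurd hx h⟩
    · rw [Function.update_of_ne hyx] at hy ⊢
      exact h y hy
  · obtain ⟨f, hf, h⟩ := hw₁ S
    refine ⟨f, h₁ hf, fun y hy => ?_⟩
    by_cases hyx : y = x
    · subst hyx
      rw [Function.update_self, hF₁ f hf]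
      exact ⟨fun h => absurd h hx, fun _ => le_rfl⟩
    · rw [Function.update_of_ne hyx] at hy ⊢
      exact h y hy

variable [Fintype ι]

open Classical in
/-- A large separated class has two large subclasses of functions taking at some point values that
differ by at least `2`. -/
theorem IsTwoSeparated.exists_large_fibers [Nonempty ι] {b N : ℕ} (hN : 1 ≤ N)
    {F : Finset (ι → ℕ)} (hF : IsTwoSeparated F) (hb : ∀ f ∈ F, ∀ i, f i ≤ b)
    (hcard : (Fintype.card ι * (b + 1) + 1) * N ≤ F.card) :
    ∃ (x : ι) (i j : ℕ), i + 2 ≤ j ∧ N ≤ (F.filter fun f => f x = i).card ∧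
      N ≤ (F.filter fun f => f x = j).card := by
  -- Each pair (point, value) accounts for at most N − 1 light functions, so at least two functions
  -- are not light. Where these two differ by 2, both fibers are large.
  set light : Finset (ι → ℕ) :=
    F.filter fun f => ∃ x, (F.filter fun f' => f' x = f x).card < N with hlight
  have hsub : light ⊆ (Finset.univ ×ˢ Finset.range (b + 1) : Finset (ι × ℕ)).biUnion fun p =>
      if (F.filter fun f => f p.1 = p.2).card < N then F.filter fun f => f p.1 = p.2 else ∅ := by
    intro f hf
    obtain ⟨hfF, x, hx⟩ := Finset.mem_filter.1 hf
    refine Finset.mem_biUnion.2 ⟨(x, f x), ?_, ?_⟩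
    · simpa using Nat.lt_succ_of_le (hb f hfF x)
    · rw [if_pos hx]
      exact Finset.mem_filter.2 ⟨hfF, rfl⟩
  have hlc : light.card ≤ Fintype.card ι * (b + 1) * (N - 1) := by
    refine (Finset.card_le_card hsub).trans ?_
    refine (Finset.card_biUnion_le_card_mul _ _ (N - 1) fun p _ => ?_).trans ?_
    · split_ifs with h
      · omega
      · simp
    · simp
  have hrest : 1 < (F \ light).card := by
    have h1 := Finset.le_card_sdiff light F
    have h2 : 1 ≤ Fintype.card ι * (b + 1) := Nat.mul_pos Fintype.card_pos (Nat.succ_pos b)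
    have h3 : Fintype.card ι * (b + 1) * (N - 1) + Fintype.card ι * (b + 1)
        = Fintype.card ι * (b + 1) * N := by
      rw [← Nat.mul_succ, Nat.succ_eq_add_one, Nat.sub_add_cancel hN]
    have h4 := add_mul (Fintype.card ι * (b + 1)) 1 N
    omega
  obtain ⟨f, hf, g, hg, hfg⟩ := Finset.one_lt_card.1 hrest
  have heavy : ∀ f ∈ F \ light, ∀ x, N ≤ (F.filter fun f' => f' x = f x).card := by
    intro f hf x
    by_contra h
    obtain ⟨h1, h2⟩ := Finset.mem_sdiff.1 hf
    exact h2 (Finset.mem_filter.2 ⟨h1, x, not_le.1 h⟩)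
  obtain ⟨x, hx⟩ := hF f (Finset.mem_sdiff.1 hf).1 g (Finset.mem_sdiff.1 hg).1 hfg
  rcases hx with hx | hx
  · exact ⟨x, f x, g x, hx, heavy f hf x, heavy g hg x⟩
  · exact ⟨x, g x, f x, hx, heavy g hg x, heavy f hf x⟩

open Classical in
/-- A separated class of cardinality at least `(n (b + 1) + 1) ^ r` strongly shatters at least
`2 ^ r` words. -/
theorem IsTwoSeparated.exists_stronglyShatters [Nonempty ι] {b : ℕ} (r : ℕ) :
    ∀ {F : Finset (ι → ℕ)}, IsTwoSeparated F → (∀ f ∈ F, ∀ i, f i ≤ b) →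
      (Fintype.card ι * (b + 1) + 1) ^ r ≤ F.card →
      ∃ W : Finset (ι → ℕ), 2 ^ r ≤ W.card ∧ ∀ w ∈ W, StronglyShatters F w := by
  induction r with
  | zero =>
    intro F _ _ hcard
    obtain ⟨f, hf⟩ := Finset.card_pos.1 (by simpa using hcard)
    refine ⟨{0}, by simp, fun w hw S => ⟨f, hf, fun i hi => ?_⟩⟩
    rw [Finset.mem_singleton.1 hw] at hi
    exact absurd rfl hi
  | succ r ih =>
    intro F hF hb hcard
    obtain ⟨x, i, j, hij, h₁, h₂⟩ := hF.exists_large_fibers (N := (Fintype.card ι * (b + 1) + 1) ^ r)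
      (Nat.one_le_pow _ _ (Nat.succ_pos _)) hb (by rwa [← pow_succ'])
    have sep : ∀ v, IsTwoSeparated (F.filter fun f => f x = v) := fun v f hf g hg =>
      hF f (Finset.mem_filter.1 hf).1 g (Finset.mem_filter.1 hg).1
    have bdd : ∀ v, ∀ f ∈ F.filter fun f => f x = v, ∀ i, f i ≤ b := fun v f hf =>
      hb f (Finset.mem_filter.1 hf).1
    have con : ∀ v, ∀ f ∈ F.filter fun f => f x = v, f x = v := fun v f hf =>
      (Finset.mem_filter.1 hf).2
    obtain ⟨W₁, hc₁, hW₁⟩ := ih (sep i) (bdd i) h₁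
    obtain ⟨W₂, hc₂, hW₂⟩ := ih (sep j) (bdd j) h₂
    have z₁ : ∀ w ∈ W₁, w x = 0 := fun w hw => (hW₁ w hw).eq_zero_of_const (con i)
    have z₂ : ∀ w ∈ W₂, w x = 0 := fun w hw => (hW₂ w hw).eq_zero_of_const (con j)
    -- A word shattered by both fibers counts twice, once unchanged and once with a level at x, so
    -- the total is |W₁| + |W₂|.
    refine ⟨(W₁ ∪ W₂) ∪ (W₁ ∩ W₂).image fun w => Function.update w x (i + 1), ?_, ?_⟩
    · rw [Finset.card_union_of_disjoint, Finset.card_image_of_injOn, Finset.card_union_add_card_inter]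
      · rw [pow_succ]; omega
      · intro w hw w' hw' h
        have h0 := z₁ w (Finset.mem_inter.1 hw).1
        have h0' := z₁ w' (Finset.mem_inter.1 hw').1
        funext y
        by_cases hy : y = x
        · rw [hy, h0, h0']
        · have := congrFun h y
          simpa [Function.update_of_ne hy] using this
      · rw [Finset.disjoint_left]
        intro w hw hw'
        obtain ⟨w', -, rfl⟩ := Finset.mem_image.1 hw'
        rcases Finset.mem_union.1 hw with h | h
        · simpa using z₁ _ h
        · simpa using z₂ _ h
    · intro w hw
      rcases Finset.mem_union.1 hw with hw | hw
      · rcases Finset.mem_union.1 hw with h | h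
        · exact (hW₁ w h).mono (Finset.filter_subset _ _)
        · exact (hW₂ w h).mono (Finset.filter_subset _ _)
      · obtain ⟨w', hw', rfl⟩ := Finset.mem_image.1 hw
        obtain ⟨h1, h2⟩ := Finset.mem_inter.1 hw'
        exact StronglyShatters.update (Finset.filter_subset _ _) (Finset.filter_subset _ _) hij
          (con i) (con j) (hW₁ w' h1) (hW₂ w' h2)

open Classical in
/-- There are at most `(n (b + 1) + 1) ^ d` words with values at most `b` and at most `d` nonzero
letters. -/
theorem card_words_le (b d : ℕ) (W : Finset (ι → ℕ)) (hb : ∀ w ∈ W, ∀ i, w i ≤ b)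
    (hd : ∀ w ∈ W, (Finset.univ.filter fun i => w i ≠ 0).card ≤ d) :
    W.card ≤ (Fintype.card ι * (b + 1) + 1) ^ d := by
  induction d generalizing W with
  | zero =>
    rw [pow_zero]
    refine Finset.card_le_one.2 fun w hw w' hw' => funext fun i => ?_
    have key : ∀ w ∈ W, w i = 0 := fun w hw => by
      have := Finset.card_eq_zero.1 (Nat.le_zero.1 (hd w hw))
      by_contra h
      have h' : i ∈ Finset.univ.filter fun i => w i ≠ 0 := by simpa using h
      rw [this] at h'
      simp at h'
    rw [key w hw, key w' hw']
  | succ d ih =>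
    set V : Finset (ι → ℕ) := (Fintype.piFinset fun _ => Finset.range (b + 1)).filter
      fun w => (Finset.univ.filter fun i => w i ≠ 0).card ≤ d with hV
    have hVc := ih V
      (fun w hw i => Nat.lt_succ_iff.1 (Finset.mem_range.1
        (Fintype.mem_piFinset.1 (Finset.mem_filter.1 hw).1 i)))
      (fun w hw => (Finset.mem_filter.1 hw).2)
    -- A word outside `V` becomes a word of `V` when one nonzero letter is erased.
    have hsub : W ⊆ V ∪ (V ×ˢ (Finset.univ ×ˢ Finset.range (b + 1) : Finset (ι × ℕ))).image
        fun p => Function.update p.1 p.2.1 p.2.2 := by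
      intro w hw
      have hwb : ∀ i, w i ∈ Finset.range (b + 1) := fun i =>
        Finset.mem_range.2 (Nat.lt_succ_of_le (hb w hw i))
      by_cases h : (Finset.univ.filter fun i => w i ≠ 0).card ≤ d
      · exact Finset.mem_union_left _
          (Finset.mem_filter.2 ⟨Fintype.mem_piFinset.2 hwb, h⟩)
      · obtain ⟨x, hx⟩ : (Finset.univ.filter fun i => w i ≠ 0).Nonempty :=
          Finset.card_pos.1 (by omega)
        refine Finset.mem_union_right _ (Finset.mem_image.2
          ⟨(Function.update w x 0, (x, w x)), ?_, by simp⟩)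
        refine Finset.mem_product.2 ⟨Finset.mem_filter.2 ⟨Fintype.mem_piFinset.2 fun i => ?_, ?_⟩,
          Finset.mem_product.2 ⟨Finset.mem_univ _, hwb x⟩⟩
        · by_cases hi : i = x
          · subst hi; simp
          · simpa [Function.update_of_ne hi] using hwb i
        · have he : (Finset.univ.filter fun i => Function.update w x 0 i ≠ 0)
              = (Finset.univ.filter fun i => w i ≠ 0).erase x := by
            ext i
            by_cases hi : i = x
            · subst hi; simp
            · simp [hi]
          rw [he, Finset.card_erase_of_mem hx]
          have := hd w hw
          omega
    calc W.card ≤ _ := Finset.card_le_card hsub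
      _ ≤ V.card + V.card * (Fintype.card ι * (b + 1)) := by
        refine (Finset.card_union_le _ _).trans (Nat.add_le_add_left ?_ _)
        refine Finset.card_image_le.trans ?_
        simp [Finset.card_product]
      _ = V.card * (Fintype.card ι * (b + 1) + 1) := by ring
      _ ≤ _ := by rw [pow_succ]; exact Nat.mul_le_mul_right _ hVc

open Classical in
/-- A Sauer-Shelah type bound on the cardinality of separated classes. -/
theorem IsTwoSeparated.card_lt [Nonempty ι] {b d r : ℕ} {F : Finset (ι → ℕ)}
    (hF : IsTwoSeparated F) (hb : ∀ f ∈ F, ∀ i, f i ≤ b)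
    (hd : ∀ w, StronglyShatters F w → (Finset.univ.filter fun i => w i ≠ 0).card ≤ d)
    (hr : (Fintype.card ι * (b + 1) + 1) ^ d < 2 ^ r) :
    F.card < (Fintype.card ι * (b + 1) + 1) ^ r := by
  by_contra h
  obtain ⟨W, hWc, hW⟩ := hF.exists_stronglyShatters r hb (not_lt.1 h)
  have := card_words_le b d W (fun w hw i => ?_) fun w hw => hd w (hW w hw)
  · omega
  · by_cases h0 : w i = 0
    · omega
    · obtain ⟨f, hf, hfw⟩ := hW w hw Set.univ
      have h1 := (hfw i h0).1 trivial
      have h2 := hb f hf i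
      omega

end StrongShattering

/-! ### Covers in the supremum norm from the fat-shattering dimension -/

section Cover

variable {T : Type*}

open Classical in
/-- A class of functions with values in `[-M, M]` whose `ρ / 2`-shattered sets have at most `d`
elements admits on a finite set small covers in the supremum norm at scale `2 * ρ`. -/
theorem exists_finset_cover {H : Set (T → ℝ)} {M ρ : ℝ} (hρ : 0 < ρ)
    (hH : ∀ f ∈ H, ∀ x, f x ∈ Set.Icc (-M) M) {d r : ℕ}
    (hd : ∀ s, Shatters H (Set.Icc (-M) M) (ρ / 2) s → s.card ≤ d) {s : Finset T}
    (hs : s.Nonempty) (hr : (s.card * (⌊2 * M / ρ⌋₊ + 1) + 1) ^ d < 2 ^ r) :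
    ∃ S : Finset (T → ℝ), (∀ f ∈ S, f ∈ H) ∧ S.card ≤ (s.card * (⌊2 * M / ρ⌋₊ + 1) + 1) ^ r ∧
      ∀ g ∈ H, ∃ f ∈ S, ∀ t ∈ s, |g t - f t| < 2 * ρ := by
  set b := ⌊2 * M / ρ⌋₊ with hb
  set q : (T → ℝ) → s → ℕ := fun g t => ⌊(g t + M) / ρ⌋₊ with hq
  have : Nonempty s := hs.to_subtype
  have hqb : ∀ g ∈ H, ∀ i, q g i ≤ b := fun g hg i => by
    refine Nat.floor_le_floor ?_
    have := (hH g hg i).2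
    gcongr
    linarith
  have hq1 : ∀ g ∈ H, ∀ i, q g i * ρ ≤ g i + M := fun g hg i => by
    have h0 : 0 ≤ (g i + M) / ρ := div_nonneg (by linarith [(hH g hg i).1]) hρ.le
    exact (le_div_iff₀ hρ).1 (Nat.floor_le h0)
  have hq2 : ∀ g, ∀ i, g i + M < (q g i + 1) * ρ := fun g i =>
    (div_lt_iff₀ hρ).1 (Nat.lt_floor_add_one _)
  have hdim : ∀ F : Finset (s → ℕ), (∀ f ∈ F, f ∈ q '' H) → ∀ w, StronglyShatters F w →
      (Finset.univ.filter fun i => w i ≠ 0).card ≤ d := by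
    intro F hF w hw
    rw [← Finset.card_map (Function.Embedding.subtype _)]
    -- The witness is the midpoint of the quantization cell of index w. Functions quantized above or
    -- below that cell clear it by half a step, ρ/2. The value 0 off `s` is a dummy.
    refine hd _ ⟨fun t => if h : t ∈ s then -M + (w ⟨t, h⟩ + 1 / 2) * ρ else 0, ?_, ?_⟩
    · intro t ht
      obtain ⟨i, hi, rfl⟩ := Finset.mem_map.1 ht
      have hi0 := (Finset.mem_filter.1 hi).2
      obtain ⟨f, hf, h⟩ := hw Set.univ
      obtain ⟨g, hg, rfl⟩ := hF f hf
      have h1 : (w i : ℝ) + 1 ≤ q g i := by exact_mod_cast (h i hi0).1 trivial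
      have h2 := hq1 g hg i
      have h3 := (hH g hg i).2
      have h4 : (w i + 1) * ρ ≤ q g i * ρ := by gcongr
      simp only [Function.Embedding.subtype_apply, Subtype.coe_eta, Finset.coe_mem, dif_pos]
      constructor
      · have : 0 ≤ ((w i : ℝ) + 1 / 2) * ρ := by positivity
        linarith
      · linarith
    · intro l hl
      obtain ⟨f, hf, h⟩ := hw {i | l i = 1}
      obtain ⟨g, hg, rfl⟩ := hF f hf
      refine ⟨g, hg, fun t ht => ?_⟩
      have hlt := hl t ht
      obtain ⟨i, hi, rfl⟩ := Finset.mem_map.1 ht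
      have hi0 := (Finset.mem_filter.1 hi).2
      simp only [Function.Embedding.subtype_apply, Subtype.coe_eta, Finset.coe_mem, dif_pos]
        at hlt ⊢
      by_cases h1 : l i = 1
      · have h2 : (w i : ℝ) + 1 ≤ q g i := by exact_mod_cast (h i hi0).1 h1
        have h3 : (w i + 1) * ρ ≤ q g i * ρ := by gcongr
        have h4 := hq1 g hg i
        rw [h1]
        linarith
      · have h2 : (q g i : ℝ) + 1 ≤ w i := by exact_mod_cast (h i hi0).2 h1
        have h3 : (q g i + 1) * ρ ≤ w i * ρ := by gcongr
        have h4 := hq2 g i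
        rw [hlt.resolve_right h1]
        linarith
  -- By maximality every quantized function is within 1 of some member everywhere, which means a
  -- distance below 2ρ before quantization.
  obtain ⟨F, hF, hmax⟩ := Finset.exists_max_image
    (((Fintype.piFinset fun _ : s => Finset.range (b + 1)).powerset).filter
      fun F => (∀ f ∈ F, f ∈ q '' H) ∧ IsTwoSeparated F) Finset.card
    ⟨∅, Finset.mem_filter.2 ⟨Finset.empty_mem_powerset _, by simp, by simp [IsTwoSeparated]⟩⟩
  obtain ⟨-, hFH, hFs⟩ := Finset.mem_filter.1 hF
  have hmem : ∀ F : Finset (s → ℕ), (∀ f ∈ F, f ∈ q '' H) →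
      F ∈ (Fintype.piFinset fun _ : s => Finset.range (b + 1)).powerset := by
    intro F hF
    refine Finset.mem_powerset.2 fun f hf => Fintype.mem_piFinset.2 fun i => ?_
    obtain ⟨g, hg, rfl⟩ := hF f hf
    exact Finset.mem_range.2 (Nat.lt_succ_of_le (hqb g hg i))
  choose! p hpH hp using hFH
  refine ⟨F.image p, ?_, ?_, ?_⟩
  · intro f hf
    obtain ⟨u, hu, rfl⟩ := Finset.mem_image.1 hf
    exact hpH u hu
  · refine Finset.card_image_le.trans ?_
    have := hFs.card_lt (b := b) (d := d) (r := r) (fun f hf i => ?_)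
      (hdim F fun f hf => ⟨p f, hpH f hf, hp f hf⟩) (by simpa using hr)
    · simpa using this.le
    · rw [← hp f hf]
      exact hqb _ (hpH f hf) i
  · intro g hg
    have key : ∃ u ∈ F, ∀ i, q g i ≤ u i + 1 ∧ u i ≤ q g i + 1 := by
      by_cases hgF : q g ∈ F
      · exact ⟨q g, hgF, fun i => ⟨Nat.le_succ _, Nat.le_succ _⟩⟩
      by_contra! hcon
      have hFH' : ∀ f ∈ insert (q g) F, f ∈ q '' H := by
        intro f hf
        rcases Finset.mem_insert.1 hf with rfl | hf
        · exact ⟨g, hg, rfl⟩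
        · exact ⟨p f, hpH f hf, hp f hf⟩
      have hsep : ∀ u ∈ F, ∃ i, q g i + 2 ≤ u i ∨ u i + 2 ≤ q g i := fun u hu => by
        obtain ⟨i, hi⟩ := hcon u hu
        refine ⟨i, ?_⟩
        by_cases h : q g i ≤ u i + 1
        · have := hi h; omega
        · omega
      have := hmax (insert (q g) F) (Finset.mem_filter.2 ⟨hmem _ hFH', hFH', ?_⟩)
      · rw [Finset.card_insert_of_notMem hgF] at this
        omega
      · intro f hf f' hf' hne
        rcases Finset.mem_insert.1 hf with rfl | hf
        · rcases Finset.mem_insert.1 hf' with rfl | hf'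
          · exact absurd rfl hne
          · exact hsep f' hf'
        · rcases Finset.mem_insert.1 hf' with rfl | hf'
          · obtain ⟨i, hi⟩ := hsep f hf
            exact ⟨i, hi.symm⟩
          · exact hFs f hf f' hf' hne
    obtain ⟨u, hu, h⟩ := key
    refine ⟨p u, Finset.mem_image_of_mem p hu, fun t ht => ?_⟩
    have h1 := hq1 g hg ⟨t, ht⟩
    have h2 := hq2 g ⟨t, ht⟩
    have h3 := hq1 (p u) (hpH u hu) ⟨t, ht⟩
    have h4 := hq2 (p u) ⟨t, ht⟩
    rw [hp u hu] at h3 h4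
    obtain ⟨h5, h6⟩ := h ⟨t, ht⟩
    have h5' : (q g ⟨t, ht⟩ : ℝ) ≤ u ⟨t, ht⟩ + 1 := by exact_mod_cast h5
    have h6' : (u ⟨t, ht⟩ : ℝ) ≤ q g ⟨t, ht⟩ + 1 := by exact_mod_cast h6
    have h7 := mul_le_mul_of_nonneg_right h5' hρ.le
    have h8 := mul_le_mul_of_nonneg_right h6' hρ.le
    simp only at h1 h2 h3 h4
    rw [abs_lt]
    constructor <;> linarith

end Cover

/-! ### Finiteness of the dimension of a uniform Glivenko-Cantelli class -/

section FiniteDimension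

variable {T : Type*}

open Classical in
/-- On a shattered set that is large compared to the sample, some member of the class has, in a
prescribed direction `c = ±1`, a large deviation relatively to that of the witness. -/
theorem Shatters.exists_deviation {F : Set (T → ℝ)} {M γ : ℝ} (hγ : 0 < γ)
    (hF : ∀ f ∈ F, ∀ x, f x ∈ Set.Icc (-M) M) {s : Finset T} {b : T → ℝ}
    (hb : ∀ t ∈ s, b t ∈ Set.Icc (-M) M)
    (hs : ∀ l : T → ℝ, (∀ t ∈ s, l t = -1 ∨ l t = 1) → ∃ f ∈ F, ∀ t ∈ s, γ ≤ l t * (f t - b t))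
    {n : ℕ} (hn : 0 < n) (hns : n * (2 * M + γ) < γ * s.card) {u : ℕ → T} (hu : ∀ i, u i ∈ s)
    {c : ℝ} (hc : c = -1 ∨ c = 1) :
    ∃ f ∈ F, γ + c * ((1 / (n : ℝ)) * ∑ i ∈ Finset.range n, b (u i)
        - (1 / (s.card : ℝ)) * ∑ t ∈ s, b t) <
      c * ((1 / (n : ℝ)) * ∑ i ∈ Finset.range n, f (u i)
        - (1 / (s.card : ℝ)) * ∑ t ∈ s, f t) := by
  set S₀ := (Finset.range n).image u with hS₀
  have hS₀s : S₀ ⊆ s := fun t ht => by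
    obtain ⟨i, -, rfl⟩ := Finset.mem_image.1 ht
    exact hu i
  have hS₀c : (S₀.card : ℝ) ≤ n := by
    have : S₀.card ≤ n := Finset.card_image_le.trans (Finset.card_range n).le
    exact_mod_cast this
  -- The function leans in direction c on the sample and in direction −c on the rest of `s`.
  obtain ⟨f, hf, h⟩ := hs (fun t => if t ∈ S₀ then c else -c) (fun t _ => by
    split_ifs
    · exact hc
    · rcases hc with h | h <;> simp [h])
  have hM : 0 ≤ M := by
    have := hb _ (hu 0)
    linarith [this.1, this.2]
  have hin : ∀ t ∈ S₀, γ ≤ c * (f t - b t) := fun t ht => by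
    have := h t (hS₀s ht)
    rwa [if_pos ht] at this
  have hout : ∀ t ∈ s \ S₀, c * (f t - b t) ≤ -γ := fun t ht => by
    obtain ⟨h1, h2⟩ := Finset.mem_sdiff.1 ht
    have := h t h1
    rw [if_neg h2] at this
    linarith
  have hle : ∀ t ∈ S₀, c * (f t - b t) ≤ 2 * M := fun t ht => by
    have h1 := hF f hf t
    have h2 := hb t (hS₀s ht)
    rcases hc with h | h <;> rw [h] <;> linarith [h1.1, h1.2, h2.1, h2.2]
  have hn' : (0 : ℝ) < n := by exact_mod_cast hn
  have hsc : (0 : ℝ) < s.card := by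
    have : 0 < s.card := Finset.card_pos.2 ⟨_, hu 0⟩
    exact_mod_cast this
  have e1 : γ ≤ (1 / (n : ℝ)) * ∑ i ∈ Finset.range n, c * (f (u i) - b (u i)) := by
    rw [one_div, le_inv_mul_iff₀ hn']
    have := Finset.card_nsmul_le_sum (Finset.range n) (fun i => c * (f (u i) - b (u i))) γ
      fun i hi => hin _ (Finset.mem_image_of_mem u hi)
    simpa using this
  -- At most n points contribute up to 2M and all others at most −γ; `hns` makes the latter prevail.
  have e2 : (1 / (s.card : ℝ)) * ∑ t ∈ s, c * (f t - b t) < 0 := by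
    refine mul_neg_of_pos_of_neg (by positivity) ?_
    rw [← Finset.sum_sdiff hS₀s]
    have a1 := Finset.sum_le_card_nsmul (s \ S₀) (fun t => c * (f t - b t)) (-γ) hout
    have a2 := Finset.sum_le_card_nsmul S₀ (fun t => c * (f t - b t)) (2 * M) hle
    rw [Finset.card_sdiff_of_subset hS₀s, nsmul_eq_mul,
      Nat.cast_sub (Finset.card_le_card hS₀s)] at a1
    rw [nsmul_eq_mul] at a2
    have a3 := mul_le_mul_of_nonneg_right hS₀c (by positivity : 0 ≤ 2 * M + γ)
    linarith
  refine ⟨f, hf, ?_⟩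
  simp only [← Finset.mul_sum, Finset.sum_sub_distrib] at e1 e2
  linarith

/-- The fat-shattering dimension of a uniform Glivenko-Cantelli class is finite at each scale. -/
theorem IsUniformGC.exists_card_le [MeasurableSpace T] {F : Set (T → ℝ)} (hGC : IsUniformGC F)
    {M γ : ℝ} (hγ : 0 < γ) (hF : ∀ f ∈ F, ∀ x, f x ∈ Set.Icc (-M) M) :
    ∃ d : ℕ, ∀ s, Shatters F (Set.Icc (-M) M) γ s → s.card ≤ d := by
  by_contra! hcon
  obtain ⟨n, hn1, hn⟩ := ((eventually_ge_atTop 1).and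
    ((hGC.2 γ hγ).eventually (gt_mem_nhds zero_lt_one))).exists
  obtain ⟨s, ⟨b, hb, hs⟩, hcard⟩ := hcon ⌈n * (2 * M + γ) / γ⌉₊
  have hns : n * (2 * M + γ) < γ * s.card := by
    rw [mul_comm γ, ← div_lt_iff₀ hγ]
    exact Nat.lt_of_ceil_lt hcard
  have hpos : 0 < s.card := by omega
  have : NeZero s.card := ⟨hpos.ne'⟩
  -- The uniform law on `s` is an image of that on a discrete finite type, so points of T need not
  -- be measurable.
  set φ : Fin s.card → T := fun j => s.equivFin.symm j with hφ
  have hφm : Measurable φ := measurable_of_finite _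
  set U : Measure (Fin s.card) := (PMF.uniformOfFintype (Fin s.card)).toMeasure with hU
  have hQ : IsProbabilityMeasure (U.map φ) := Measure.isProbabilityMeasure_map hφm.aemeasurable
  have hint : ∀ f ∈ F, ∫ x, f x ∂(U.map φ) = (1 / (s.card : ℝ)) * ∑ t ∈ s, f t := by
    intro f hf
    rw [integral_map hφm.aemeasurable (hGC.1 f hf).aestronglyMeasurable, hU, PMF.integral_eq_sum]
    simp only [PMF.uniformOfFintype_apply, Fintype.card_fin, ENNReal.toReal_inv,
      ENNReal.toReal_natCast, smul_eq_mul, ← Finset.mul_sum, one_div]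
    rw [← Finset.sum_coe_sort s, ← s.equivFin.symm.sum_comp]
  have hφω : Measurable fun (u : ℕ → Fin s.card) i => φ (u i) :=
    measurable_pi_lambda _ fun i => hφm.comp (measurable_pi_apply i)
  refine absurd hn (not_lt.2 ?_)
  refine le_trans ?_ (le_iSup _ (⟨U.map φ, hQ⟩ : ProbabilityMeasure T))
  simp only [ProbabilityMeasure.coe_mk]
  rw [← Measure.infinitePi_map_pi (μ := fun _ : ℕ => U) (f := fun _ => φ) (fun _ => hφm)]
  -- This inequality holds for arbitrary sets, so the event need not be measurable; its preimage
  -- turns out to be the whole space.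
  refine le_trans ?_ (Measure.le_map_apply hφω.aemeasurable _)
  rw [← measure_univ (μ := Measure.infinitePi fun _ : ℕ => U)]
  refine measure_mono fun u _ => ⟨n, le_rfl, ?_⟩
  have hu : ∀ i, φ (u i) ∈ s := fun i => (s.equivFin.symm (u i)).2
  -- The direction is chosen so that the deviation of the witness adds to γ instead of cancelling
  -- it.
  rcases le_total 0 ((1 / (n : ℝ)) * ∑ i ∈ Finset.range n, b (φ (u i))
        - (1 / (s.card : ℝ)) * ∑ t ∈ s, b t) with h0 | h0
  · obtain ⟨f, hf, h⟩ := Shatters.exists_deviation hγ hF hb hs hn1 hns hu (Or.inr rfl)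
    refine ⟨f, hf, ?_⟩
    rw [hint f hf]
    exact lt_of_lt_of_le (by linarith) (le_abs_self _)
  · obtain ⟨f, hf, h⟩ := Shatters.exists_deviation hγ hF hb hs hn1 hns hu (Or.inl rfl)
    refine ⟨f, hf, ?_⟩
    rw [hint f hf]
    exact lt_of_lt_of_le (by linarith) (neg_le_abs _)

/-- The largest fat-shattering dimension of the component classes of a margin class is finite. -/
theorem IsMarginClass.exists_maxFatDim_eq {X : Type*} {C : ℕ} [MeasurableSpace X] {M : ℝ}
    {𝒢 : Fin C → Set (X → ℝ)} (h : IsMarginClass M 𝒢) {ε : ℝ} (hε : 0 < ε) :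
    ∃ d : ℕ, maxFatDim M 𝒢 ε = d := by
  choose D hD using fun k => (h.gc k).exists_card_le hε (h.mem_Icc k)
  have hle : maxFatDim M 𝒢 ε ≤ ((∑ k, D k : ℕ) : ℕ∞) := by
    refine iSup_le fun k => iSup₂_le fun s hs => ?_
    exact_mod_cast (hD k s hs).trans (Finset.single_le_sum (fun _ _ => Nat.zero_le _)
      (Finset.mem_univ k))
  obtain ⟨d, hd⟩ := ENat.ne_top_iff_exists.1 (ne_top_of_le_ne_top (ENat.natCast_ne_top _) hle)
  exact ⟨d, hd.symm⟩

theorem Shatters.card_le_of_maxFatDim {X : Type*} {C : ℕ} {M ε : ℝ} {𝒢 : Fin C → Set (X → ℝ)}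
    {d : ℕ} (hd : maxFatDim M 𝒢 ε = d) {k : Fin C} {s : Finset X}
    (hs : Shatters (𝒢 k) (Set.Icc (-M) M) ε s) : s.card ≤ d := by
  have h1 : (s.card : ℕ∞) ≤ fatDim (𝒢 k) (Set.Icc (-M) M) ε :=
    le_iSup₂ (f := fun (s : Finset X) (_ : Shatters (𝒢 k) (Set.Icc (-M) M) ε s) => (s.card : ℕ∞))
      s hs
  have h2 := h1.trans (le_iSup (fun k => fatDim (𝒢 k) (Set.Icc (-M) M) ε) k)
  exact_mod_cast h2.trans hd.le

end FiniteDimension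

/-! ### Random signs -/

section Rademacher

open Classical in
/-- Hoeffding's inequality for Rademacher sums, in counting form. -/
theorem card_rademacher_le {m : ℕ} (a : Fin m → ℝ) (ha : ∀ i, |a i| ≤ 1) {η : ℝ} (hη : 0 ≤ η) :
    ((Finset.univ.filter fun σ : Fin m → Bool =>
      m * η < ∑ i, if σ i then a i else -a i).card : ℝ) ≤
      2 ^ m * Real.exp (-(m * η ^ 2 / 2)) := by
  have hprod : ∑ σ : Fin m → Bool, Real.exp (∑ i, η * if σ i then a i else -a i)
      = ∏ i, (Real.exp (η * a i) + Real.exp (η * -a i)) := by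
    simp only [Real.exp_sum]
    rw [← Fintype.piFinset_univ,
      ← Finset.prod_univ_sum (fun _ : Fin m => (Finset.univ : Finset Bool))
        fun i c => Real.exp (η * if c then a i else -a i)]
    simp
  have hbound : ∏ i, (Real.exp (η * a i) + Real.exp (η * -a i))
      ≤ 2 ^ m * Real.exp (m * η ^ 2 / 2) := by
    calc ∏ i, (Real.exp (η * a i) + Real.exp (η * -a i))
        ≤ ∏ _i : Fin m, 2 * Real.exp (η ^ 2 / 2) := by
          refine Finset.prod_le_prod (fun i _ => by positivity) fun i _ => ?_
          have h1 := Real.cosh_le_exp_half_sq (η * a i)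
          have h2 : (η * a i) ^ 2 ≤ η ^ 2 := by
            rw [mul_pow]
            have := (sq_le_one_iff_abs_le_one (a i)).2 (ha i)
            nlinarith [sq_nonneg η]
          have h3 : Real.exp ((η * a i) ^ 2 / 2) ≤ Real.exp (η ^ 2 / 2) := by gcongr
          rw [Real.cosh_eq] at h1
          rw [mul_neg]
          linarith
      _ = 2 ^ m * Real.exp (m * η ^ 2 / 2) := by
          rw [Finset.prod_const, Finset.card_univ, Fintype.card_fin, mul_pow, ← Real.exp_nat_mul,
            mul_div_assoc]
  -- Chernoff's bound with parameter η, the minimizer of λ ↦ m λ²/2 − λ m η.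
  have hmarkov : ((Finset.univ.filter fun σ : Fin m → Bool =>
      m * η < ∑ i, if σ i then a i else -a i).card : ℝ) * Real.exp (m * η ^ 2) ≤
      ∑ σ : Fin m → Bool, Real.exp (∑ i, η * if σ i then a i else -a i) := by
    rw [← nsmul_eq_mul]
    refine (Finset.card_nsmul_le_sum _ _ _ fun σ hσ => ?_).trans
      (Finset.sum_le_sum_of_subset_of_nonneg (Finset.subset_univ _) fun _ _ _ => by positivity)
    have := (Finset.mem_filter.1 hσ).2
    rw [← Finset.mul_sum]
    refine Real.exp_le_exp.2 ?_
    nlinarith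
  rw [hprod] at hmarkov
  have h := hmarkov.trans hbound
  rw [← le_div_iff₀ (Real.exp_pos _), mul_div_assoc, ← Real.exp_sub] at h
  rwa [show (m : ℝ) * η ^ 2 / 2 - m * η ^ 2 = -(m * η ^ 2 / 2) by ring] at h

end Rademacher

/-! ### Comparison of the losses of nearby functions -/

section Losses

theorem indicatorLoss_eq (t : ℝ) : indicatorLoss t = if t ≤ 0 then 1 else 0 := by
  simp [indicatorLoss, Set.indicator_apply]

theorem marginLoss_eq (γ t : ℝ) : marginLoss γ t = if t < γ then 1 else 0 := by
  simp [marginLoss, Set.indicator_apply]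

theorem indicatorLoss_mem (t : ℝ) : indicatorLoss t ∈ Set.Icc (0 : ℝ) 1 := by
  rw [indicatorLoss_eq]; split_ifs <;> simp

theorem marginLoss_mem (γ t : ℝ) : marginLoss γ t ∈ Set.Icc (0 : ℝ) 1 := by
  rw [marginLoss_eq]; split_ifs <;> simp

theorem measurable_indicatorLoss : Measurable indicatorLoss :=
  measurable_one.indicator measurableSet_Iic

theorem measurable_marginLoss (γ : ℝ) : Measurable (marginLoss γ) :=
  measurable_one.indicator measurableSet_Iio

/-- Together with the next comparison, at r = γ/2, this places the margin loss of an approximating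
function between the error and the γ-margin loss of the original one. -/
theorem indicatorLoss_le_marginLoss {s t r : ℝ} (h : |s - t| < r) :
    indicatorLoss s ≤ marginLoss r t := by
  rw [indicatorLoss_eq, marginLoss_eq]
  rw [abs_lt] at h
  split_ifs
  all_goals first | (exfalso; linarith) | norm_num

theorem marginLoss_le_marginLoss {s t r r' : ℝ} (h : |s - t| < r') :
    marginLoss r t ≤ marginLoss (r + r') s := by
  rw [marginLoss_eq, marginLoss_eq]
  rw [abs_lt] at h
  split_ifs
  all_goals first | (exfalso; linarith) | norm_num

end Losses

/-! ### Double samples, random swaps and symmetrization -/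

section Symmetrization

variable {Z : Type*}

/-- Exchange the two components of the pair `w i` at the indices `i` with `σ i = false`. -/
def swapBy {m : ℕ} (σ : Fin m → Bool) (w : Fin m → Z × Z) : Fin m → Z × Z :=
  fun i => if σ i then w i else (w i).swap

/-- The double samples on which, for some member of the class, the number of errors on the second
half exceeds by more than `m * η` the number of margin errors on the first half. -/
def deviationSet (F : Set (Z → ℝ)) (m : ℕ) (γ η : ℝ) : Set (Fin m → Z × Z) :=
  {w | ∃ f ∈ F, m * η < ∑ i, (indicatorLoss (f (w i).2) - marginLoss γ (f (w i).1))}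

-- Passing to a nearby cover element h only increases the deviation, after which both halves carry
-- the same loss at margin γ/2. A swap then just flips the sign of a term, so the Rademacher bound
-- and a union bound over `N` apply.
open Classical in
theorem card_swapBy_mem_deviationSet_le {F : Set (Z → ℝ)} {m : ℕ} {γ η : ℝ} (hη : 0 ≤ η)
    (w : Fin m → Z × Z) (N : Finset (Z → ℝ))
    (hN : ∀ f ∈ F, ∃ h ∈ N, ∀ i, |f (w i).1 - h (w i).1| < γ / 2 ∧
      |f (w i).2 - h (w i).2| < γ / 2) :
    ((Finset.univ.filter fun σ => swapBy σ w ∈ deviationSet F m γ η).card : ℝ) ≤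
      N.card * Real.exp (-(m * η ^ 2 / 2)) * 2 ^ m := by
  set a : (Z → ℝ) → Fin m → ℝ := fun h i =>
    marginLoss (γ / 2) (h (w i).2) - marginLoss (γ / 2) (h (w i).1) with ha
  have hsub : (Finset.univ.filter fun σ => swapBy σ w ∈ deviationSet F m γ η) ⊆
      N.biUnion fun h => Finset.univ.filter fun σ : Fin m → Bool =>
        m * η < ∑ i, if σ i then a h i else -a h i := by
    intro σ hσ
    obtain ⟨f, hf, hlt⟩ := (Finset.mem_filter.1 hσ).2
    obtain ⟨h, hhN, hh⟩ := hN f hf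
    refine Finset.mem_biUnion.2 ⟨h, hhN, Finset.mem_filter.2 ⟨Finset.mem_univ _,
      hlt.trans_le (Finset.sum_le_sum fun i _ => ?_)⟩⟩
    obtain ⟨h1, h2⟩ := hh i
    have h3 := indicatorLoss_le_marginLoss h1
    have h4 := indicatorLoss_le_marginLoss h2
    have h5 := marginLoss_le_marginLoss (r := γ / 2) h1
    have h6 := marginLoss_le_marginLoss (r := γ / 2) h2
    rw [add_halves] at h5 h6
    simp only [swapBy, ha]
    split_ifs
    · linarith
    · simp only [Prod.snd_swap, Prod.fst_swap]
      linarith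
  calc ((Finset.univ.filter fun σ => swapBy σ w ∈ deviationSet F m γ η).card : ℝ)
      ≤ ∑ h ∈ N, ((Finset.univ.filter fun σ : Fin m → Bool =>
        m * η < ∑ i, if σ i then a h i else -a h i).card : ℝ) := by
        exact_mod_cast (Finset.card_le_card hsub).trans Finset.card_biUnion_le
    _ ≤ ∑ _h ∈ N, 2 ^ m * Real.exp (-(m * η ^ 2 / 2)) :=
        Finset.sum_le_sum fun h _ => card_rademacher_le _ (fun i => by
          have h1 := marginLoss_mem (γ / 2) (h (w i).2)
          have h2 := marginLoss_mem (γ / 2) (h (w i).1)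
          rw [abs_le]
          constructor <;> simp only [ha] <;> linarith [h1.1, h1.2, h2.1, h2.2]) hη
    _ = _ := by rw [Finset.sum_const, nsmul_eq_mul]; ring

variable [MeasurableSpace Z] (P : Measure Z) [IsProbabilityMeasure P]

theorem measurePreserving_swapBy {m : ℕ} (σ : Fin m → Bool) :
    MeasurePreserving (swapBy σ) (Measure.pi fun _ : Fin m => P.prod P)
      (Measure.pi fun _ : Fin m => P.prod P) := by
  have hi : ∀ i, MeasurePreserving (fun v : Z × Z => if σ i then v else v.swap)
      (P.prod P) (P.prod P) := fun i => ?_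
  · exact measurePreserving_pi _ _ hi
  by_cases h : σ i
  · simp only [h, if_true]
    exact MeasurePreserving.id _
  · simpa [h] using Measure.measurePreserving_swap

/-- A null measurable set of double samples has small measure if, for each double sample, few of
its exchanges belong to it. -/
theorem measure_le_of_card_swapBy_le {m : ℕ} {A : Set (Fin m → Z × Z)}
    (hA : NullMeasurableSet A (Measure.pi fun _ : Fin m => P.prod P)) {κ : ℝ} (hκ : 0 ≤ κ)
    (h : ∀ w, (Nat.card {σ : Fin m → Bool // swapBy σ w ∈ A} : ℝ) ≤ κ * 2 ^ m) :
    Measure.pi (fun _ : Fin m => P.prod P) A ≤ ENNReal.ofReal κ := by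
  classical
  set μ := Measure.pi fun _ : Fin m => P.prod P with hμ
  have hnull : ∀ σ : Fin m → Bool, NullMeasurableSet (swapBy σ ⁻¹' A) μ := fun σ =>
    hA.preimage (measurePreserving_swapBy P σ).quasiMeasurePreserving
  -- All swaps preserve μ, so the measure of A is an average over σ; exchanging sum and integral
  -- leaves a count for each fixed double sample.
  have h1 : (2 ^ m : ENNReal) * μ A = ∑ σ : Fin m → Bool, μ (swapBy σ ⁻¹' A) := by
    rw [Finset.sum_congr rfl fun σ _ =>
      (measurePreserving_swapBy P σ).measure_preimage hA]
    simp [hμ]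
  have h2 : ∑ σ : Fin m → Bool, μ (swapBy σ ⁻¹' A)
      = ∫⁻ w, ∑ σ : Fin m → Bool, (swapBy σ ⁻¹' A).indicator (fun _ => 1) w ∂μ := by
    rw [lintegral_finsetSum' _ fun σ _ => aemeasurable_const.indicator₀ (hnull σ)]
    exact Finset.sum_congr rfl fun σ _ => by
      rw [lintegral_indicator_const₀ (hnull σ), one_mul]
  have h3 : ∫⁻ w, ∑ σ : Fin m → Bool, (swapBy σ ⁻¹' A).indicator (fun _ => 1) w ∂μ
      ≤ ∫⁻ _, ENNReal.ofReal (κ * 2 ^ m) ∂μ := by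
    refine lintegral_mono fun w => ?_
    have : ∑ σ : Fin m → Bool, (swapBy σ ⁻¹' A).indicator (fun _ => (1 : ENNReal)) w
        = ((Nat.card {σ : Fin m → Bool // swapBy σ w ∈ A} : ℕ) : ENNReal) := by
      simp [Set.indicator_apply, Fintype.card_subtype]
    rw [this, ← ENNReal.ofReal_natCast]
    exact ENNReal.ofReal_le_ofReal (h w)
  rw [h2.symm.trans h1.symm, lintegral_const, measure_univ, mul_one, mul_comm,
    ENNReal.ofReal_mul hκ, ENNReal.ofReal_pow (by norm_num), ENNReal.ofReal_ofNat] at h3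
  exact (ENNReal.mul_le_mul_iff_left (by simp) (by simp)).1 h3

/-- Transports the measurability hypothesis, stated for samples of 2m single points, to m pairs. -/
theorem measurePreserving_append (m : ℕ) :
    MeasurePreserving
      (fun w : Fin m → Z × Z => Fin.append (fun i => (w i).1) (fun i => (w i).2))
      (Measure.pi fun _ : Fin m => P.prod P) (Measure.pi fun _ : Fin (m + m) => P) := by
  have hm : Measurable
      (fun w : Fin m → Z × Z => Fin.append (fun i => (w i).1) (fun i => (w i).2)) := by
    refine measurable_pi_lambda _ fun j => ?_
    refine Fin.addCases (fun i => ?_) (fun i => ?_) j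
    · simp only [Fin.append_left]
      fun_prop
    · simp only [Fin.append_right]
      fun_prop
  refine ⟨hm, (Measure.pi_eq fun s hs => ?_).symm⟩
  rw [Measure.map_apply hm (MeasurableSet.univ_pi hs)]
  have : (fun w : Fin m → Z × Z => Fin.append (fun i => (w i).1) (fun i => (w i).2)) ⁻¹'
      Set.univ.pi s = Set.univ.pi fun i => s (Fin.castAdd m i) ×ˢ s (Fin.natAdd m i) := by
    ext w
    simp only [Set.mem_preimage, Set.mem_univ_pi, Set.mem_prod]
    constructor
    · intro h i
      have h1 := h (Fin.castAdd m i)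
      have h2 := h (Fin.natAdd m i)
      rw [Fin.append_left] at h1
      rw [Fin.append_right] at h2
      exact ⟨h1, h2⟩
    · intro h j
      refine Fin.addCases (fun i => ?_) (fun i => ?_) j
      · rw [Fin.append_left]
        exact (h i).1
      · rw [Fin.append_right]
        exact (h i).2
  rw [this, Measure.pi_pi, Fin.prod_univ_add, ← Finset.prod_mul_distrib]
  simp [Measure.prod_prod]

theorem IsMeasurableClass.nullMeasurableSet_deviationSet {F : Set (Z → ℝ)}
    (hF : IsMeasurableClass P F) (m : ℕ) (γ η : ℝ) :
    NullMeasurableSet (deviationSet F m γ η) (Measure.pi fun _ : Fin m => P.prod P) := by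
  have hB : MeasurableSet {v : Fin (m + m) → ℝ | m * η <
      ∑ i, (indicatorLoss (v (Fin.natAdd m i)) - marginLoss γ (v (Fin.castAdd m i)))} := by
    refine measurableSet_lt measurable_const (Finset.measurable_sum _ fun i _ => ?_)
    exact (measurable_indicatorLoss.comp (measurable_pi_apply _)).sub
      ((measurable_marginLoss γ).comp (measurable_pi_apply _))
  have := (hF (m + m) _ hB).preimage (measurePreserving_append P m).quasiMeasurePreserving
  convert this using 1
  ext w
  simp only [deviationSet, Set.mem_preimage, Set.mem_ofPred_eq, Fin.append_left, Fin.append_right]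

/-- If the expected number of errors on a sample of size `m` is at least one, then the number of
errors exceeds its expectation minus one with probability at least `1 / m`. -/
theorem inv_le_measure_sum_indicatorLoss {m : ℕ} (hm : 0 < m) {f : Z → ℝ} (hf : Measurable f)
    (h1 : 1 ≤ m * ∫ z, indicatorLoss (f z) ∂P) :
    ENNReal.ofReal (1 / m) ≤ Measure.pi (fun _ : Fin m => P)
      {z | m * ∫ z, indicatorLoss (f z) ∂P - 1 < ∑ i, indicatorLoss (f (z i))} := by
  set R := ∫ z, indicatorLoss (f z) ∂P with hR
  set μ := Measure.pi fun _ : Fin m => P with hμ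
  set V := {z : Fin m → Z | m * R - 1 < ∑ i, indicatorLoss (f (z i))} with hV
  have hmf : Measurable fun z => indicatorLoss (f z) := measurable_indicatorLoss.comp hf
  have hVm : MeasurableSet V := measurableSet_lt measurable_const
    (Finset.measurable_sum _ fun i _ => hmf.comp (measurable_pi_apply i))
  have hint : ∀ i : Fin m, Integrable (fun z : Fin m → Z => indicatorLoss (f (z i))) μ := fun i =>
    Integrable.of_mem_Icc 0 1 (hmf.comp (measurable_pi_apply i)).aemeasurable
      (Eventually.of_forall fun z => indicatorLoss_mem _)
  have hsum : ∫ z, ∑ i, indicatorLoss (f (z i)) ∂μ = m * R := by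
    rw [integral_finsetSum _ fun i _ => hint i]
    have : ∀ i : Fin m, ∫ z, indicatorLoss (f (z i)) ∂μ = R := fun i => by
      have hp := measurePreserving_eval (fun _ : Fin m => P) i
      rw [hR, ← hp.map_eq, integral_map hp.measurable.aemeasurable hmf.aestronglyMeasurable]
    simp [this]
  have hle : ∫ z, ∑ i, indicatorLoss (f (z i)) ∂μ
      ≤ ∫ z, ((m * R - 1) + m * V.indicator (fun _ => (1 : ℝ)) z) ∂μ := by
    have hi : Integrable (fun z => (m : ℝ) * V.indicator (fun _ => (1 : ℝ)) z) μ :=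
      ((integrable_const (1 : ℝ)).indicator hVm).const_mul _
    refine integral_mono (integrable_finsetSum _ fun i _ => hint i)
      ((integrable_const _).add hi) fun z => ?_
    -- On V the sum is at most m, hence at most mR − 1 + m because mR ≥ 1; off V it is at most mR −
    -- 1.
    by_cases hz : z ∈ V
    · have : ∑ i, indicatorLoss (f (z i)) ≤ ∑ _i : Fin m, (1 : ℝ) :=
        Finset.sum_le_sum fun i _ => (indicatorLoss_mem _).2
      simp only [Finset.sum_const, Finset.card_univ, Fintype.card_fin, nsmul_eq_mul, mul_one]
        at this
      simp only [Set.indicator_of_mem hz]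
      linarith
    · simp only [Set.indicator_of_notMem hz]
      simpa using not_lt.1 hz
  rw [hsum, integral_add (integrable_const _)
    (((integrable_const (1 : ℝ)).indicator hVm).const_mul _), integral_const_mul,
    integral_indicator_const _ hVm] at hle
  simp only [integral_const, probReal_univ, smul_eq_mul, one_mul, mul_one] at hle
  have hm' : (0 : ℝ) < m := by exact_mod_cast hm
  rw [← ENNReal.ofReal_toReal (measure_ne_top μ V)]
  refine ENNReal.ofReal_le_ofReal ?_
  rw [div_le_iff₀ hm']
  change 1 ≤ μ.real V * m
  linarith

/-- Symmetrization: the probability of a large uniform deviation is at most `m` times the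
probability of the corresponding deviation on a double sample. -/
theorem exists_measurableSet_of_deviationSet_le {F : Set (Z → ℝ)} (hF : ∀ f ∈ F, Measurable f)
    {m : ℕ} (hm : 0 < m) {γ η : ℝ} (hη : 0 ≤ η) {κ : ENNReal}
    (hκ : Measure.pi (fun _ : Fin m => P.prod P) (deviationSet F m γ η) ≤ κ) :
    ∃ E : Set (Fin m → Z), MeasurableSet E ∧ Measure.pi (fun _ : Fin m => P) Eᶜ ≤ m * κ ∧
      ∀ z ∈ E, ∀ f ∈ F, m * ∫ z, indicatorLoss (f z) ∂P
        ≤ ∑ i, marginLoss γ (f (z i)) + m * η + 1 := by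
  set μ := Measure.pi fun _ : Fin m => P with hμ
  set A : Set ((Fin m → Z) × (Fin m → Z)) :=
    (MeasurableEquiv.arrowProdEquivProdArrow Z Z (Fin m)).symm ⁻¹' deviationSet F m γ η with hA
  have hAκ : (μ.prod μ) A ≤ κ := by
    have := (measurePreserving_arrowProdEquivProdArrow Z Z (Fin m)
      (fun _ => P) (fun _ => P)).symm.measure_preimage_equiv (deviationSet F m γ η)
    rw [hA, this]
    exact hκ
  -- A measurable hull has the same measure and measurable section measures. Markov's inequality
  -- then controls the first samples whose section has measure at least 1/m.
  set A' := toMeasurable (μ.prod μ) A with hA'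
  have hA'm : MeasurableSet A' := measurableSet_toMeasurable _ _
  have hsec : Measurable fun z => μ (Prod.mk z ⁻¹' A') := measurable_measure_prodMk_left hA'm
  have hm' : (0 : ℝ) < m := by exact_mod_cast hm
  refine ⟨{z | μ (Prod.mk z ⁻¹' A') < ENNReal.ofReal (1 / m)},
    measurableSet_lt hsec measurable_const, ?_, ?_⟩
  · have h1 := mul_meas_ge_le_lintegral hsec (ENNReal.ofReal (1 / m)) (μ := μ)
    rw [← Measure.prod_apply hA'm, hA', measure_toMeasurable] at h1
    have h2 : {z | μ (Prod.mk z ⁻¹' A') < ENNReal.ofReal (1 / m)}ᶜ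
        = {z | ENNReal.ofReal (1 / m) ≤ μ (Prod.mk z ⁻¹' A')} := by
      ext z; simp
    rw [h2]
    have h3 : (m : ENNReal) * ENNReal.ofReal (1 / m) = 1 := by
      rw [← ENNReal.ofReal_natCast, ← ENNReal.ofReal_mul hm'.le, mul_one_div_cancel hm'.ne',
        ENNReal.ofReal_one]
    calc _ = (m : ENNReal) * (ENNReal.ofReal (1 / m)
          * μ {z | ENNReal.ofReal (1 / m) ≤ μ (Prod.mk z ⁻¹' A')}) := by
          rw [← mul_assoc, h3, one_mul]
      _ ≤ m * κ := by gcongr; exact h1.trans hAκ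
  · intro z hz f hf
    by_contra! hlt
    have h0 : 0 ≤ ∑ i, marginLoss γ (f (z i)) :=
      Finset.sum_nonneg fun i _ => (marginLoss_mem γ _).1
    have hη' : 0 ≤ m * η := by positivity
    -- A failure at f forces m times the risk above 1, so second samples with nearly the expected
    -- number of errors have mass at least 1/m. They all lie in the section over z, which is
    -- smaller.
    have hinv := inv_le_measure_sum_indicatorLoss P hm (hF f hf) (by linarith)
    refine absurd (hinv.trans (measure_mono fun z' hz' => ?_)) (not_le.2 hz)
    refine subset_toMeasurable _ _ ⟨f, hf, ?_⟩
    have hz'' := Set.mem_ofPred.1 hz'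
    rw [Finset.sum_sub_distrib]
    change m * η < ∑ i, indicatorLoss (f (z' i)) - ∑ i, marginLoss γ (f (z i))
    linarith

end Symmetrization

/-! ### Hoeffding's inequality for one function -/

section SingleFunction

variable {Z : Type*} [MeasurableSpace Z] (P : Measure Z) [IsProbabilityMeasure P]

/-- Hoeffding's inequality for the empirical mean of a function with values in `[0, 1]`. -/
theorem measure_empirical_deviation_le {m : ℕ} {φ : Z → ℝ} (hφ : Measurable φ)
    (h01 : ∀ z, φ z ∈ Set.Icc (0 : ℝ) 1) {η : ℝ} (hη : 0 ≤ η) :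
    (Measure.pi fun _ : Fin m => P).real {z | ∑ i, φ (z i) + m * η ≤ m * ∫ z, φ z ∂P} ≤
      Real.exp (-(2 * m * η ^ 2)) := by
  set R := ∫ z, φ z ∂P with hR
  have hsub : ∀ i ∈ (Finset.univ : Finset (Fin m)), ProbabilityTheory.HasSubgaussianMGF
      (fun z : Fin m → Z => R - φ (z i)) ((‖(0 : ℝ) - -1‖₊ / 2) ^ 2)
      (Measure.pi fun _ : Fin m => P) := by
    intro i _
    have hp := measurePreserving_eval (fun _ : Fin m => P) i
    have hint : ∫ z : Fin m → Z, -φ (z i) ∂(Measure.pi fun _ : Fin m => P) = -R := by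
      rw [integral_neg, hR]
      conv_rhs => rw [← hp.map_eq,
        integral_map hp.measurable.aemeasurable hφ.aestronglyMeasurable]
    have := ProbabilityTheory.hasSubgaussianMGF_of_mem_Icc (μ := Measure.pi fun _ : Fin m => P)
      (X := fun z : Fin m → Z => -φ (z i)) (a := -1) (b := 0)
      (hφ.comp (measurable_pi_apply i)).neg.aemeasurable
      (Eventually.of_forall fun z => ⟨by linarith [(h01 (z i)).2], by linarith [(h01 (z i)).1]⟩)
    rw [hint] at this
    convert this using 2
    ring
  have hind : ProbabilityTheory.iIndepFun (fun (i : Fin m) (z : Fin m → Z) => R - φ (z i))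
      (Measure.pi fun _ : Fin m => P) :=
    ProbabilityTheory.iIndepFun_pi (X := fun _ v => R - φ v)
      fun _ => (hφ.const_sub R).aemeasurable
  have := ProbabilityTheory.HasSubgaussianMGF.measure_sum_ge_le_of_iIndepFun hind hsub
    (ε := m * η) (by positivity)
  have hset : {z : Fin m → Z | ∑ i, φ (z i) + m * η ≤ m * R}
      = {z | m * η ≤ ∑ i, (R - φ (z i))} := by
    ext z
    simp only [Set.mem_ofPred_eq, Finset.sum_sub_distrib, Finset.sum_const, Finset.card_univ,
      Fintype.card_fin, nsmul_eq_mul]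
    constructor <;> intro h <;> linarith
  rw [hset]
  refine this.trans (Real.exp_le_exp.2 (le_of_eq ?_))
  rcases Nat.eq_zero_or_pos m with rfl | hm
  · simp
  have hm' : (m : ℝ) ≠ 0 := by positivity
  simp only [Finset.sum_const, Finset.card_univ, Fintype.card_fin, nsmul_eq_mul]
  have : ((((‖(0 : ℝ) - -1‖₊ / 2) ^ 2 : NNReal)) : ℝ) = 1 / 4 := by norm_num
  push_cast at this ⊢
  rw [this]
  field_simp
  ring

end SingleFunction

/-! ### Margin functions, their covers and the two cases of the bound -/

section Margin

variable {X : Type*} {C : ℕ}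

/-- Compare at the best competitor for h: two scores move by less than ε each, and the factor 1/2
compensates. -/
theorem marginFun_lt_add (hC : 2 ≤ C) {g h : Fin C → X → ℝ} {z : X × Fin C} {ε : ℝ}
    (H : ∀ k, |g k z.1 - h k z.1| < ε) : marginFun g z < marginFun h z + ε := by
  have hne : Nonempty {l : Fin C // l ≠ z.2} := by
    have : Nontrivial (Fin C) := Fin.nontrivial_iff_two_le.2 hC
    obtain ⟨l, hl⟩ := exists_ne z.2
    exact ⟨⟨l, hl⟩⟩
  obtain ⟨l, hl⟩ := exists_eq_ciSup_of_finite (f := fun l : {l : Fin C // l ≠ z.2} => h l z.1)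
  have h1 : g l z.1 ≤ ⨆ l : {l : Fin C // l ≠ z.2}, g l z.1 :=
    le_ciSup (f := fun l : {l : Fin C // l ≠ z.2} => g l z.1) (Set.finite_range _).bddAbove l
  have h2 := abs_lt.1 (H l)
  have h3 := abs_lt.1 (H z.2)
  unfold marginFun
  rw [← hl]
  linarith [h2.1, h3.2]

/-- The margin function depends on the component functions in a nonexpansive way. -/
theorem abs_marginFun_sub_lt (hC : 2 ≤ C) {g h : Fin C → X → ℝ} {z : X × Fin C} {ε : ℝ}
    (H : ∀ k, |g k z.1 - h k z.1| < ε) : |marginFun g z - marginFun h z| < ε := by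
  have h1 := marginFun_lt_add hC H
  have h2 := marginFun_lt_add hC (g := h) (h := g) (z := z) (ε := ε)
    fun k => by rw [abs_sub_comm]; exact H k
  rw [abs_lt]
  constructor <;> linarith

/-- A class that shatters no singleton has small diameter. -/
theorem abs_sub_lt_of_shatters_card_le_zero {H : Set (X → ℝ)} {M ε : ℝ}
    (hH : ∀ f ∈ H, ∀ x, f x ∈ Set.Icc (-M) M)
    (hd : ∀ s, Shatters H (Set.Icc (-M) M) ε s → s.card ≤ 0) {f g : X → ℝ} (hf : f ∈ H)
    (hg : g ∈ H) (x : X) : |f x - g x| < 2 * ε := by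
  have key : ∀ f ∈ H, ∀ g ∈ H, f x - g x < 2 * ε := by
    intro f hf g hg
    by_contra! hcon
    -- Two values at distance at least 2ε shatter the point around their midpoint.
    have := hd {x} ⟨fun _ => (f x + g x) / 2, ?_, ?_⟩
    · simp at this
    · intro t _
      have h1 := hH f hf x
      have h2 := hH g hg x
      constructor <;> linarith [h1.1, h1.2, h2.1, h2.2]
    · intro l hl
      rcases hl x (Finset.mem_singleton_self x) with h | h
      · refine ⟨g, hg, fun t ht => ?_⟩
        rw [Finset.mem_singleton.1 ht, h]
        linarith
      · refine ⟨f, hf, fun t ht => ?_⟩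
        rw [Finset.mem_singleton.1 ht, h]
        linarith
  rw [abs_lt]
  constructor
  · linarith [key g hg f hf]
  · exact key f hf g hg

/-- Comparison of the combinatorial cover bound with an exponential of a squared logarithm. -/
theorem exists_cover_exponent {M γ : ℝ} (hM : 1 ≤ M) (hγ : γ ∈ Set.Ioc (0 : ℝ) 1) {m d : ℕ}
    (hm : 0 < m) (hd : 0 < d) {n : ℕ} (hn : n ≤ 2 * m) :
    ∃ r : ℕ, (n * (⌊2 * M / (γ / 4)⌋₊ + 1) + 1) ^ d < 2 ^ r ∧
      (((n * (⌊2 * M / (γ / 4)⌋₊ + 1) + 1) ^ r : ℕ) : ℝ) ≤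
        Real.exp (3 * d * Real.log (128 * M ^ 2 * m / γ ^ 2) ^ 2
          - Real.log (128 * M ^ 2 * m / γ ^ 2)) := by
  obtain ⟨hγ0, hγ1⟩ := hγ
  set x := M / γ with hx
  have hx1 : 1 ≤ x := (one_le_div hγ0).2 (hγ1.trans hM)
  have hA : 128 * M ^ 2 * m / γ ^ 2 = 128 * x ^ 2 * m := by rw [hx]; field_simp
  rw [hA]
  have hm1 : (1 : ℝ) ≤ m := by exact_mod_cast hm
  have hd1 : (1 : ℝ) ≤ d := by exact_mod_cast hd
  set A := 128 * x ^ 2 * m with hAdef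
  have hxx : x ≤ x ^ 2 := by nlinarith
  have hxm : (m : ℝ) ≤ x ^ 2 * m := by nlinarith
  have hA128 : 128 ≤ A := by rw [hAdef]; nlinarith
  have hA0 : 0 < A := by linarith
  set K := n * (⌊2 * M / (γ / 4)⌋₊ + 1) + 1 with hK
  have hKA : (K : ℝ) ≤ A := by
    have h1 : (⌊2 * M / (γ / 4)⌋₊ : ℝ) ≤ 8 * x := by
      have h0 : 2 * M / (γ / 4) = 8 * x := by rw [hx]; field_simp; norm_num
      rw [h0]
      exact Nat.floor_le (by linarith)
    have h2 : (n : ℝ) ≤ 2 * m := by exact_mod_cast hn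
    have h3 : (n : ℝ) * (⌊2 * M / (γ / 4)⌋₊ + 1) ≤ 2 * m * (8 * x + 1) := by gcongr
    rw [hK]
    push_cast
    have h4 : (m : ℝ) * x ≤ m * x ^ 2 := by gcongr
    rw [hAdef]
    nlinarith
  have hK0 : (0 : ℝ) < K := by rw [hK]; positivity
  set L := Real.log A with hL
  have hL2 : 2 ≤ L := by
    rw [hL, Real.le_log_iff_exp_le hA0]
    have h1 := Real.exp_one_lt_d9
    have h2 : Real.exp 2 = Real.exp 1 * Real.exp 1 := by rw [← Real.exp_add]; norm_num
    rw [h2]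
    nlinarith [Real.exp_pos 1]
  have hlog2 := Real.log_two_gt_d9
  have hlog2' : 0 < Real.log 2 := by linarith
  -- The least r with exp(d L) < 2 ^ r; it suffices since K ≤ A = exp L.
  refine ⟨⌊d * L / Real.log 2⌋₊ + 1, ?_, ?_⟩
  · have h1 : (d : ℝ) * L < (⌊d * L / Real.log 2⌋₊ + 1 : ℕ) * Real.log 2 := by
      rw [← div_lt_iff₀ hlog2']
      exact_mod_cast Nat.lt_floor_add_one (d * L / Real.log 2)
    have h2 : (K : ℝ) ^ d < 2 ^ (⌊d * L / Real.log 2⌋₊ + 1) := by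
      refine (pow_le_pow_left₀ hK0.le hKA d).trans_lt ?_
      rw [← Real.log_lt_log_iff (by positivity) (by positivity), Real.log_pow, Real.log_pow]
      exact h1
    exact_mod_cast h2
  · push_cast
    refine (pow_le_pow_left₀ hK0.le hKA _).trans ?_
    rw [← Real.log_le_iff_le_exp (by positivity), Real.log_pow, ← hL]
    -- As 1/ln 2 ≤ 3/2, the exponent r L is at most (3/2) d L² + L. Doubling the constant to 3
    -- absorbs + L and leaves − L to spare, because L ≥ 2 and d ≥ 1.
    have h1 : (⌊d * L / Real.log 2⌋₊ : ℝ) ≤ 3 / 2 * (d * L) := by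
      refine (Nat.floor_le (by positivity)).trans ?_
      rw [div_le_iff₀ hlog2']
      have : 0 ≤ d * L := by positivity
      nlinarith
    push_cast
    have h2 : (⌊d * L / Real.log 2⌋₊ : ℝ) * L ≤ 3 / 2 * (d * L) * L := by gcongr
    have h3 : L ≤ d * L := by nlinarith
    nlinarith

variable [MeasurableSpace X] {M : ℝ} {𝒢 : Fin C → Set (X → ℝ)}

open Classical in
/-- On a double sample, the class of margin functions has a small cover. -/
theorem IsMarginClass.exists_marginFun_cover (h𝒢 : IsMarginClass M 𝒢) (hC : 2 ≤ C) {γ : ℝ}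
    (hγ : γ ∈ Set.Ioc (0 : ℝ) 1) {m d : ℕ} (hm : 0 < m) (hd : 0 < d)
    (hdim : maxFatDim M 𝒢 (γ / 8) = d) (w : Fin m → (X × Fin C) × (X × Fin C)) :
    ∃ N : Finset (X × Fin C → ℝ), (N.card : ℝ) ≤
        Real.exp (C * (3 * d * Real.log (128 * M ^ 2 * m / γ ^ 2) ^ 2
          - Real.log (128 * M ^ 2 * m / γ ^ 2))) ∧
      ∀ f ∈ marginFunClass 𝒢, ∃ h ∈ N, ∀ i, |f (w i).1 - h (w i).1| < γ / 2 ∧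
        |f (w i).2 - h (w i).2| < γ / 2 := by
  set s : Finset X := (Finset.univ.image fun i => (w i).1.1) ∪
    Finset.univ.image fun i => (w i).2.1 with hs
  have hscard : s.card ≤ 2 * m := by
    refine (Finset.card_union_le _ _).trans ?_
    have h1 := Finset.card_image_le (s := Finset.univ) (f := fun i => (w i).1.1)
    have h2 := Finset.card_image_le (s := Finset.univ) (f := fun i => (w i).2.1)
    simp only [Finset.card_univ, Fintype.card_fin] at h1 h2
    omega
  have hs1 : ∀ i, (w i).1.1 ∈ s := fun i =>
    Finset.mem_union_left _ (Finset.mem_image_of_mem (fun i => (w i).1.1) (Finset.mem_univ i))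
  have hs2 : ∀ i, (w i).2.1 ∈ s := fun i =>
    Finset.mem_union_right _ (Finset.mem_image_of_mem (fun i => (w i).2.1) (Finset.mem_univ i))
  obtain ⟨r, hr1, hr2⟩ := exists_cover_exponent h𝒢.one_le hγ hm hd hscard
  have hγ4 : 0 < γ / 4 := by linarith [hγ.1]
  -- With step ρ = γ/4 the covers have radius 2ρ = γ/2 and the shattering scale is ρ/2 = γ/8.
  have hcov := fun k => exists_finset_cover (H := 𝒢 k) (ρ := γ / 4) hγ4 (h𝒢.mem_Icc k)
    (d := d) (r := r) (s := s) (fun t ht => by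
      rw [div_div] at ht
      norm_num at ht
      exact Shatters.card_le_of_maxFatDim hdim ht) ⟨_, hs1 ⟨0, hm⟩⟩ hr1
  choose S hSH hSc hS using hcov
  refine ⟨(Fintype.piFinset S).image marginFun, ?_, ?_⟩
  · have h1 : (((Fintype.piFinset S).image marginFun).card : ℝ) ≤ ∏ k, ((S k).card : ℝ) := by
      rw [← Nat.cast_prod, ← Fintype.card_piFinset]
      exact_mod_cast Finset.card_image_le
    refine h1.trans ((Finset.prod_le_prod (fun _ _ => Nat.cast_nonneg _) fun k _ =>
      (Nat.cast_le.2 (hSc k)).trans hr2).trans (le_of_eq ?_))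
    rw [Finset.prod_const, Finset.card_univ, Fintype.card_fin, ← Real.exp_nat_mul]
  · rintro f ⟨g, hg, rfl⟩
    choose h hhS hh using fun k => hS k (g k) (hg k trivial)
    refine ⟨marginFun h, Finset.mem_image_of_mem _ (Fintype.mem_piFinset.2 hhS), fun i => ?_⟩
    have e : 2 * (γ / 4) = γ / 2 := by ring
    rw [e] at hh
    exact ⟨abs_marginFun_sub_lt hC fun k => hh k _ (hs1 i),
      abs_marginFun_sub_lt hC fun k => hh k _ (hs2 i)⟩

variable (P : Measure (X × Fin C))

theorem risk_le_of_sum_le {m : ℕ} (hm : 0 < m) {γ η : ℝ} {g : Fin C → X → ℝ}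
    {z : Fin m → X × Fin C}
    (h : m * ∫ z, indicatorLoss (marginFun g z) ∂P
      ≤ ∑ i, marginLoss γ (marginFun g (z i)) + m * η + 1) :
    risk P g ≤ empiricalMarginRisk γ z g + η + 1 / m := by
  have hm' : (0 : ℝ) < m := by exact_mod_cast hm
  have h2 : ∑ i, marginLoss γ (marginFun g (z i)) + m * η + 1
      = m * (empiricalMarginRisk γ z g + η + 1 / m) := by
    unfold empiricalMarginRisk
    field_simp
  rw [h2] at h
  exact le_of_mul_le_mul_left h hm'

variable [IsProbabilityMeasure P]

/-- The uniform deviation bound for a class of positive fat-shattering dimension. -/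
theorem IsMarginClass.exists_event_of_dim_pos (h𝒢 : IsMarginClass M 𝒢) (hC : 2 ≤ C)
    (hmeas : IsMeasurableClass P (marginFunClass 𝒢)) {γ : ℝ} (hγ : γ ∈ Set.Ioc (0 : ℝ) 1)
    {m d : ℕ} (hm : 0 < m) (hd : 0 < d) (hdim : maxFatDim M 𝒢 (γ / 8) = d) {δ η : ℝ}
    (hδ : 0 < δ) (hη : 0 ≤ η)
    (hηδ : m * η ^ 2 / 2 = 3 * C * d * Real.log (128 * M ^ 2 * m / γ ^ 2) ^ 2 + Real.log (2 / δ)) :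
    ∃ E : Set (Fin m → X × Fin C), MeasurableSet E ∧
      Measure.pi (fun _ : Fin m => P) Eᶜ ≤ ENNReal.ofReal δ ∧
      ∀ z ∈ E, ∀ g : Fin C → X → ℝ, (∀ k, g k ∈ 𝒢 k) →
        risk P g ≤ empiricalMarginRisk γ z g + η + 1 / m := by
  classical
  set L := Real.log (128 * M ^ 2 * m / γ ^ 2) with hL
  set κ := Real.exp (C * (3 * d * L ^ 2 - L)) * Real.exp (-(m * η ^ 2 / 2)) with hκ
  have hdev := measure_le_of_card_swapBy_le P
    (hmeas.nullMeasurableSet_deviationSet P m γ η) (κ := κ) (by positivity) fun w => by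
      obtain ⟨N, hNc, hN⟩ := h𝒢.exists_marginFun_cover hC hγ hm hd hdim w
      have := card_swapBy_mem_deviationSet_le hη w N hN
      rw [Nat.card_eq_fintype_card, Fintype.card_subtype]
      refine this.trans ?_
      rw [hκ]
      gcongr
  obtain ⟨E, hE, hEc, hEb⟩ := exists_measurableSet_of_deviationSet_le P
    (fun f hf => by
      obtain ⟨g, hg, rfl⟩ := hf
      exact measurable_marginFun fun k => (h𝒢.gc k).1 _ (hg k trivial)) hm hη hdev
  refine ⟨E, hE, hEc.trans ?_, fun z hz g hg => risk_le_of_sum_le P hm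
    (hEb z hz _ ⟨g, fun k _ => hg k, rfl⟩)⟩
  rw [← ENNReal.ofReal_natCast, ← ENNReal.ofReal_mul (Nat.cast_nonneg _)]
  refine ENNReal.ofReal_le_ofReal ?_
  have hm1 : (1 : ℝ) ≤ m := by exact_mod_cast hm
  have hx1 : 1 ≤ M / γ := (one_le_div hγ.1).2 (hγ.2.trans h𝒢.one_le)
  have hA : (m : ℝ) ≤ 128 * M ^ 2 * m / γ ^ 2 := by
    have : 128 * M ^ 2 * m / γ ^ 2 = 128 * (M / γ) ^ 2 * m := by
      have := hγ.1.ne'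
      field_simp
    rw [this]
    have h2 : 1 ≤ (M / γ) ^ 2 := one_le_pow₀ hx1
    nlinarith
  have hmL : (m : ℝ) ≤ Real.exp L := by
    rwa [hL, Real.exp_log (by linarith)]
  have hL0 : 0 ≤ L := Real.log_nonneg (hm1.trans hA)
  have hC1 : (1 : ℝ) ≤ C := by exact_mod_cast (by omega : 1 ≤ C)
  -- The terms 3 C d L² cancel, leaving exp(-C L) δ/2 with C ≥ 1; the factor exp(-L) offsets the m
  -- of the symmetrization.
  have hκ' : κ ≤ Real.exp (-L) * (δ / 2) := by
    have : δ / 2 = Real.exp (-Real.log (2 / δ)) := by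
      rw [Real.exp_neg, Real.exp_log (by positivity), inv_div]
    rw [hκ, this, hηδ, ← Real.exp_add, ← Real.exp_add, Real.exp_le_exp]
    nlinarith
  calc m * κ ≤ Real.exp L * (Real.exp (-L) * (δ / 2)) := by gcongr
    _ = δ / 2 := by rw [← mul_assoc, ← Real.exp_add, add_neg_cancel, Real.exp_zero, one_mul]
    _ ≤ δ := by linarith

/-- The uniform deviation bound for a class of fat-shattering dimension zero. -/
theorem IsMarginClass.exists_event_of_dim_zero (h𝒢 : IsMarginClass M 𝒢) (hC : 2 ≤ C) {γ : ℝ}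
    (hγ : 0 < γ) {m : ℕ} (hm : 0 < m) (hdim : maxFatDim M 𝒢 (γ / 8) = (0 : ℕ)) {δ η : ℝ}
    (hδ : δ ∈ Set.Ioo (0 : ℝ) 1) (hη : 0 ≤ η) (hηδ : m * η ^ 2 / 2 = Real.log (2 / δ)) :
    ∃ E : Set (Fin m → X × Fin C), MeasurableSet E ∧
      Measure.pi (fun _ : Fin m => P) Eᶜ ≤ ENNReal.ofReal δ ∧
      ∀ z ∈ E, ∀ g : Fin C → X → ℝ, (∀ k, g k ∈ 𝒢 k) →
        risk P g ≤ empiricalMarginRisk γ z g + η + 1 / m := by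
  by_cases hne : ∃ g₀ : Fin C → X → ℝ, ∀ k, g₀ k ∈ 𝒢 k
  swap
  · exact ⟨Set.univ, MeasurableSet.univ, by simp, fun z _ g hg => absurd ⟨g, hg⟩ hne⟩
  obtain ⟨g₀, hg₀⟩ := hne
  have hf₀ : Measurable (marginFun g₀) := measurable_marginFun fun k => (h𝒢.gc k).1 _ (hg₀ k)
  have hφ : Measurable fun z => marginLoss (γ / 2) (marginFun g₀ z) :=
    (measurable_marginLoss _).comp hf₀
  have hoeff := measure_empirical_deviation_le P (m := m) hφ (fun z => marginLoss_mem _ _) hη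
  refine ⟨{z | m * ∫ z, marginLoss (γ / 2) (marginFun g₀ z) ∂P
    ≤ ∑ i, marginLoss (γ / 2) (marginFun g₀ (z i)) + m * η}, ?_, ?_, ?_⟩
  · exact measurableSet_le measurable_const ((Finset.measurable_sum _ fun i _ =>
      hφ.comp (measurable_pi_apply i)).add measurable_const)
  · rw [← ENNReal.ofReal_toReal (measure_ne_top _ _)]
    refine ENNReal.ofReal_le_ofReal ?_
    refine (measureReal_mono fun z hz => ?_).trans (hoeff.trans ?_)
    · exact (not_le.1 (Set.notMem_ofPred_iff.1 hz)).le
    -- Here 2 m η² = 4 ln(2/δ), so Hoeffding's bound is (δ/2)⁴ ≤ δ.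
    · have h1 : Real.log δ < 0 := Real.log_neg hδ.1 hδ.2
      have h2 : Real.log (2 / δ) = Real.log 2 - Real.log δ :=
        Real.log_div (by norm_num) hδ.1.ne'
      have h3 := Real.log_pos one_lt_two
      rw [← Real.le_log_iff_exp_le hδ.1]
      linarith
  · intro z hz g hg
    -- Dimension zero at scale γ/8 keeps the components within γ/4 everywhere, so the fixed `g₀`
    -- stands for every g, independently of the sample.
    have hclose : ∀ v, |marginFun g v - marginFun g₀ v| < γ / 2 := fun v => by
      refine abs_marginFun_sub_lt hC fun k => ?_
      have := abs_sub_lt_of_shatters_card_le_zero (h𝒢.mem_Icc k)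
        (fun s hs => Shatters.card_le_of_maxFatDim hdim hs) (hg k) (hg₀ k) v.1
      linarith
    have hfg : Measurable (marginFun g) := measurable_marginFun fun k => (h𝒢.gc k).1 _ (hg k)
    refine risk_le_of_sum_le P hm ?_
    have h1 : ∫ z, indicatorLoss (marginFun g z) ∂P
        ≤ ∫ z, marginLoss (γ / 2) (marginFun g₀ z) ∂P := by
      refine integral_mono ?_ ?_ fun v => indicatorLoss_le_marginLoss (hclose v)
      · exact Integrable.of_mem_Icc 0 1 (measurable_indicatorLoss.comp hfg).aemeasurable
          (Eventually.of_forall fun v => indicatorLoss_mem _)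
      · exact Integrable.of_mem_Icc 0 1 hφ.aemeasurable
          (Eventually.of_forall fun v => marginLoss_mem _ _)
    have h2 : ∑ i, marginLoss (γ / 2) (marginFun g₀ (z i))
        ≤ ∑ i, marginLoss γ (marginFun g (z i)) := Finset.sum_le_sum fun i _ => by
      have := marginLoss_le_marginLoss (r := γ / 2) (hclose (z i))
      rwa [add_halves] at this
    have h3 : m * ∫ z, indicatorLoss (marginFun g z) ∂P
        ≤ m * ∫ z, marginLoss (γ / 2) (marginFun g₀ z) ∂P := by gcongr
    have h4 := Set.mem_ofPred.1 hz
    linarith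

end Margin

end MarginClassification

/-! ### The margin bound -/

theorem theorem2 {X : Type*} [MeasurableSpace X] (C m : ℕ) (hC : 3 ≤ C) (hm : C < m)
    (P : MeasureTheory.Measure (X × Fin C)) [MeasureTheory.IsProbabilityMeasure P]
    (M : ℝ) (𝒢 : Fin C → Set (X → ℝ)) (h𝒢 : MarginClassification.IsMarginClass M 𝒢)
    (hmeas : MarginClassification.IsMeasurableClass P (MarginClassification.marginFunClass 𝒢))
    (γ : ℝ) (hγ : γ ∈ Set.Ioc (0 : ℝ) 1) (δ : ℝ) (hδ : δ ∈ Set.Ioo (0 : ℝ) 1) :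
    ∃ d : ℕ, MarginClassification.maxFatDim M 𝒢 (γ / 8) = d ∧
      ∃ E : Set (Fin m → X × Fin C), MeasurableSet E ∧
        ENNReal.ofReal (1 - δ) ≤ MeasureTheory.Measure.pi (fun _ : Fin m => P) E ∧
        ∀ z ∈ E, ∀ g : Fin C → X → ℝ, (∀ k, g k ∈ 𝒢 k) →
          MarginClassification.risk P g ≤
            MarginClassification.empiricalMarginRisk γ z g
              + √((2 / (m : ℝ)) * (3 * (C : ℝ) * (d : ℝ)
                  * Real.log (128 * M ^ 2 * (m : ℝ) / γ ^ 2) ^ 2 + Real.log (2 / δ)))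
              + 1 / (m : ℝ) := by
  obtain ⟨d, hd⟩ := h𝒢.exists_maxFatDim_eq (ε := γ / 8) (by linarith [hγ.1])
  refine ⟨d, hd, ?_⟩
  have hm0 : 0 < m := by omega
  have hm' : (0 : ℝ) < m := by exact_mod_cast hm0
  have hlog : 0 ≤ Real.log (2 / δ) :=
    Real.log_nonneg (by rw [one_le_div hδ.1]; linarith [hδ.2])
  set η := √((2 / (m : ℝ)) * (3 * (C : ℝ) * (d : ℝ)
    * Real.log (128 * M ^ 2 * (m : ℝ) / γ ^ 2) ^ 2 + Real.log (2 / δ))) with hη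
  have hη2 : m * η ^ 2 / 2 = 3 * C * d * Real.log (128 * M ^ 2 * m / γ ^ 2) ^ 2
      + Real.log (2 / δ) := by
    rw [hη, Real.sq_sqrt (by positivity)]
    field_simp
  have key : ∃ E : Set (Fin m → X × Fin C), MeasurableSet E ∧
      MeasureTheory.Measure.pi (fun _ : Fin m => P) Eᶜ ≤ ENNReal.ofReal δ ∧
      ∀ z ∈ E, ∀ g : Fin C → X → ℝ, (∀ k, g k ∈ 𝒢 k) →
        MarginClassification.risk P g ≤
          MarginClassification.empiricalMarginRisk γ z g + η + 1 / m := by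
    -- For d = 0 the cover bound would be exp(-C L) < 1, which no cover of a nonempty class can
    -- satisfy.
    rcases Nat.eq_zero_or_pos d with rfl | hd0
    · exact h𝒢.exists_event_of_dim_zero P (by omega) hγ.1 hm0 hd hδ (Real.sqrt_nonneg _)
        (by simpa using hη2)
    · exact h𝒢.exists_event_of_dim_pos P (by omega) hmeas hγ hm0 hd0 hd hδ.1
        (Real.sqrt_nonneg _) hη2
  obtain ⟨E, hE, hEc, hEb⟩ := key
  refine ⟨E, hE, ?_, hEb⟩
  rw [ENNReal.ofReal_sub _ hδ.1.le, ENNReal.ofReal_one, tsub_le_iff_right,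
    ← MeasureTheory.prob_add_prob_compl (μ := MeasureTheory.Measure.pi fun _ : Fin m => P) hE]
  gcongr
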